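/- **Setting.** Let $H$ be a real Hilbert space with inner product $\langle\cdot,\cdot\rangle$ (for example $L^2(\mathbb R^N;\mathbb R^K)$), and let $V$ be a real Hilbert space densely and continuously embedded in $H$, with dual $V'\supseteq H$ (for example $V=H^1$). Let the acceleration operator $\mathbf M:V\to V'$ be a Hermitian, positive-definite topological isomorphism, so that $V$ is its energy space. Let $\mathbf L_{00}:V\to V'$ be a (nonlinear) operator and let $u\in V$, $\mu\in\mathbb R$ satisfy $\mathbf L_0u:=\mathbf L_{00}u-\mu u=0$, where $\mathbf L_{00}$ is twice continuously differentiable near $u$. Let $\mathbf L_1:V\to V'$ be the Fréchet derivative of $\mathbf L_0$ with respect to $u$, and $\mathbf L_1^\dagger:V\to V'$ its adjoint, $\langle \mathbf L_1^\dagger\varphi,\psi\rangle=\langle \mathbf L_1\psi,\varphi\rangle$. The iteration SOMI with time step $\Delta t$ is $$u_{n+1}=u_n-\left[\mathbf M^{-1}\mathbf L_1^\dagger\mathbf M^{-1}\mathbf L_0u\right]_{u=u_n,\,\mu=\mu_n}\Delta t,\qquad \mu_{n+1}=\mu_n+\langle u,\mathbf M^{-1}\mathbf L_0u\rangle\big|_{u=u_n,\,\mu=\mu_n}\,\Delta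 t .$$ With $\mathbf L_1$ taken at the solution $(u,\mu)$, the augmented linearized operator on $V\times\mathbb R$ is $$\mathcal L_I\begin{pmatrix}\tilde u\\ \tilde\mu\end{pmatrix}=\begin{pmatrix}-\mathbf M^{-1}\mathbf L_1^\dagger\mathbf M^{-1}(\mathbf L_1\tilde u-\tilde\mu u)\\ \langle u,\mathbf M^{-1}(\mathbf L_1\tilde u-\tilde\mu u)\rangle\end{pmatrix}.$$ **Assumptions.** (1) There is a family $U(c)$, $c=(c_1,\dots,c_s)\in\mathbb R^s$ ($s\ge 0$), continuously differentiable near some $c^0$, of solutions of $\mathbf L_{00}U(c)-\mu U(c)=0$ ($c$ near $c^0$) with $U(c^0)=u$, and the kernel of $\mathbf L_1$ is spanned by the invariance modes $\partial U/\partial c_j(c^0)$, $1\le j\le s$. (2) $u$ is not orthogonal to $\ker\mathbf L_1^\dagger$. **Claim.** The equation $\mathbf L_1F=u$ has no solution $F\in V$. The spectrum of $\mathcal L_I$ has a minimum $\Lambda_{\min}$, and $\Lambda_{\min}<0$. Moreover: (a) Convergence. Suppose that the range of $\mathbf L_1$ is closed in $V'$, and let $0<\Delta t<-2/\Lambda_{\min}$.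 Then for every $\varepsilon>0$ there is $\delta>0$ such that, for every initial condition $(u_0,\mu_0)$ within $\delta$ of $(u,\mu)$ in $V\times\mathbb R$, the SOMI iterates converge in $V\times\mathbb R$ to $(U(c),\mu)$ for some $c$ with $|c-c^0|<\varepsilon$ and $\mathbf L_{00}U(c)-\mu U(c)=0$; that is, they converge to the solitary wave up to a slight shift of the free parameters. (b) Divergence. Let $\Delta t>-2/\Lambda_{\min}$. Then there is $\varepsilon>0$ such that arbitrarily close to $(u,\mu)$ there are initial conditions for which some SOMI iterate is at distance at least $\varepsilon$ from $(u,\mu)$. If moreover the interval $(\Lambda_{\min},-2/\Delta t]$ is not contained in the spectrum of $\mathcal L_I$ (for example, if $\Lambda_{\min}$ is an isolated point of the spectrum), then $\varepsilon>0$ can be chosen such that the initial conditions for which some SOMI iterate is at distance at least $\varepsilon$ from $(u,\mu)$ are dense in $V\times\mathbb R$. -/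

import Mathlib

open Filter Topology

open scoped RealInnerProductSpace

namespace SOMI

/-! Setting. `H` is the real Hilbert space carrying the inner product `⟨·,·⟩` (for vector functions of
`x ∈ ℝᴺ` it is `L²(ℝᴺ; ℝᴷ)`), and `V ⊆ H` is the energy space of the acceleration operator, i.e. the
form domain of `M` (for `M = c - Δ` it is `H¹(ℝᴺ; ℝᴷ)`).  As usual, operators such as `M`, `L₀₀`, `L₁`
act from `V` to its dual `V' ⊇ H`; the inclusion `V ⊆ H` is written `ι`, and `T u v` is `⟨T u, v⟩`. -/

variable {V : Type*} [NormedAddCommGroup V] [InnerProductSpace ℝ V]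
  {H : Type*} [NormedAddCommGroup H] [InnerProductSpace ℝ H]

/-- The inclusion `V ⊆ H ⊆ V'`: `u` is regarded as the functional `v ↦ ⟨u, v⟩`. -/
noncomputable def toDual (ι : V →L[ℝ] H) : V →L[ℝ] StrongDual ℝ V :=
  (innerSL ℝ (E := H)).bilinearComp ι ι

/-- The operator `L₀ u = L₀₀ u - μ u`. -/
noncomputable def L0 (ι : V →L[ℝ] H) (L00 : V → StrongDual ℝ V) (μ : ℝ) (u : V) :
    StrongDual ℝ V :=
  L00 u - μ • toDual ι u

/-- The linearization `L₁` of `L₀` (with `μ` fixed) around `u`. -/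
noncomputable def L1 (ι : V →L[ℝ] H) (L00 : V → StrongDual ℝ V) (μ : ℝ) (u : V) :
    V →L[ℝ] StrongDual ℝ V :=
  fderiv ℝ (L0 ι L00 μ) u

/-- The Hermitian adjoint `L₁†`, i.e. `⟨L₁† φ, ψ⟩ = ⟨L₁ ψ, φ⟩`. -/
noncomputable def L1adj (ι : V →L[ℝ] H) (L00 : V → StrongDual ℝ V) (μ : ℝ) (u : V) :
    V →L[ℝ] StrongDual ℝ V :=
  (L1 ι L00 μ u).flip

/-- One step `(uₙ, μₙ) ↦ (uₙ₊₁, μₙ₊₁)` of the iteration: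
`uₙ₊₁ = uₙ - [M⁻¹ L₁† M⁻¹ L₀ u] Δt` and `μₙ₊₁ = μₙ + ⟨u, M⁻¹ L₀ u⟩ Δt`,
the brackets being evaluated at `u = uₙ`, `μ = μₙ`. -/
noncomputable def step (M : V ≃L[ℝ] StrongDual ℝ V) (ι : V →L[ℝ] H)
    (L00 : V → StrongDual ℝ V) (Δt : ℝ) (z : V × ℝ) : V × ℝ :=
  (z.1 - Δt • M.symm (L1adj ι L00 z.2 z.1 (M.symm (L0 ι L00 z.2 z.1))),
   z.2 + Δt * ⟪ι z.1, ι (M.symm (L0 ι L00 z.2 z.1))⟫)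

/-- The linearized residual `(ũ, μ̃) ↦ L₁ ũ - μ̃ u`. -/
noncomputable def linResidual (ι : V →L[ℝ] H) (L00 : V → StrongDual ℝ V) (μ : ℝ) (u : V) :
    (V × ℝ) →L[ℝ] StrongDual ℝ V :=
  (L1 ι L00 μ u).comp (ContinuousLinearMap.fst ℝ V ℝ)
    - (ContinuousLinearMap.snd ℝ V ℝ).smulRight (toDual ι u)

/-- The augmented linearized operator
`𝓛_I (ũ, μ̃) = (-M⁻¹ L₁† M⁻¹ (L₁ ũ - μ̃ u), ⟨u, M⁻¹ (L₁ ũ - μ̃ u)⟩)`. -/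
noncomputable def augmented (M : V ≃L[ℝ] StrongDual ℝ V) (ι : V →L[ℝ] H)
    (L00 : V → StrongDual ℝ V) (μ : ℝ) (u : V) : (V × ℝ) →L[ℝ] (V × ℝ) :=
  let Minv : StrongDual ℝ V →L[ℝ] V := M.symm
  let R := linResidual ι L00 μ u
  (-(Minv.comp ((L1adj ι L00 μ u).comp (Minv.comp R)))).prod
    ((toDual ι u).comp (Minv.comp R))

theorem augmented_apply (M : V ≃L[ℝ] StrongDual ℝ V) (ι : V →L[ℝ] H)
    (L00 : V → StrongDual ℝ V) (μ : ℝ) (u v : V) (ν : ℝ) :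
    augmented M ι L00 μ u (v, ν) =
      (-M.symm (L1adj ι L00 μ u (M.symm (L1 ι L00 μ u v - ν • toDual ι u))),
        ⟪ι u, ι (M.symm (L1 ι L00 μ u v - ν • toDual ι u))⟫) := by
  simp [augmented, linResidual, toDual, inner_sub_right, inner_smul_right]

/-- `U(c₁, …, c_s)` is a continuously differentiable family of solutions of `L₀₀ u - μ u = 0` (for
`c` near `c₀`) through `u = U(c₀)`, and the kernel of `L₁` at `u` is spanned by the invariance modes
`∂U/∂c_j` at `c₀`. -/
structure KernelOnlyInvarianceModes (ι : V →L[ℝ] H) (L00 : V → StrongDual ℝ V) (μ : ℝ) (u : V)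
    {s : ℕ} (U : EuclideanSpace ℝ (Fin s) → V) (c₀ : EuclideanSpace ℝ (Fin s)) : Prop where
  base : U c₀ = u
  smooth : ContDiffAt ℝ 1 U c₀
  solution : ∀ᶠ c in 𝓝 c₀, L0 ι L00 μ (U c) = 0
  kernel : (L1 ι L00 μ u : V →ₗ[ℝ] StrongDual ℝ V).ker =
    Submodule.span ℝ (Set.range fun j : Fin s => fderiv ℝ U c₀ (EuclideanSpace.single j 1))

end SOMI

/-! On `V × ℝ` take the inner product `⟨M v, v'⟩ + ν ν'`, complete and equivalent to the given norm
because `M` is coercive. In it the factor `feedback` of a SOMI step is minus the adjoint of the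
preconditioned linearized residual, so `T = -𝓛_I` is symmetric and nonnegative, with `⟨T z, z'⟩ = ⟨R
z, M⁻¹ R z'⟩` for `R = linResidual` (`energyForm_augmented`). Pairing `L₁ F = u` with an element of
`ker L₁†` not orthogonal to `u` shows it to be unsolvable, so `ker T = ker R = ker L₁ × 0`. Thus `T
≠ 0`, the bottom of the spectrum of `𝓛_I` is `-‖T‖` (`IsPositive.norm_mem_spectrum`), and the step
with time `t` has derivative `1 - t T`. The threshold is `t ‖T‖ = 2`.

Below it, a closed range of `L₁` bounds `T` away from zero on `(ker T)ᗮ`, where `1 - t T` is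
therefore a strict contraction. The kernel itself is tangent to the family of exact fixed points `(U
c, μ)`, so an orbit approaches the family geometrically and drifts along it by a summable amount
(`eventually_exists_tendsto_iterate`).

Above it, `1 - t T` is symmetric of norm greater than one. Its norm need not be attained, so nearly
maximal vectors replace eigenvectors, and a quadratic remainder lets the orbit follow the linear
growth (`exists_iterate_dist_ge`). If some `a` with `2 / t ≤ a < ‖T‖` is off the spectrum of `T`,
the quadratic form of `T - b`, with `b` just above `a`, is expanded by the step; two nearby orbits
whose difference has a positive value must separate, so no open set of starting points stays near
the wave (`dense_exists_iterate_dist_ge`). -/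

namespace SOMI

/-! ### Positive operators: norm, Rayleigh quotient and spectrum -/

section PositiveOperators

variable {E : Type*} [NormedAddCommGroup E] [InnerProductSpace ℝ E]

theorem IsPositive.inner_nonneg {T : E →L[ℝ] E} (hT : T.IsPositive) (x : E) : 0 ≤ ⟪T x, x⟫ :=
  hT.2 x

/-- Positivity tested at `x - ‖T‖⁻¹ T x`. This stands in for a square root of `T` and needs no
completeness. -/
theorem IsPositive.norm_apply_sq_le {T : E →L[ℝ] E} (hT : T.IsPositive) (x : E) :
    ‖T x‖ ^ 2 ≤ ‖T‖ * ⟪T x, x⟫ := by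
  rcases (norm_nonneg T).eq_or_lt with h0 | h0
  · have : T = 0 := norm_eq_zero.1 h0.symm
    simp [this]
  set s : ℝ := ‖T‖⁻¹ with hs
  have hs0 : 0 < s := inv_pos.2 h0
  have hsT : s * ‖T‖ = 1 := inv_mul_cancel₀ h0.ne'
  have h1 := IsPositive.inner_nonneg hT (x - s • T x)
  have h2 : ⟪T (T x), x⟫ = ‖T x‖ ^ 2 := by
    rw [hT.inner_left_eq_inner_right, real_inner_self_eq_norm_sq]
  have h3 : ⟪T (T x), T x⟫ ≤ ‖T‖ * ‖T x‖ ^ 2 := by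
    calc ⟪T (T x), T x⟫ ≤ ‖T (T x)‖ * ‖T x‖ := real_inner_le_norm _ _
      _ ≤ ‖T‖ * ‖T x‖ * ‖T x‖ := by gcongr; exact T.le_opNorm _
      _ = _ := by ring
  simp only [map_sub, map_smul, inner_sub_left, inner_sub_right, real_inner_smul_left,
    real_inner_smul_right, h2, real_inner_self_eq_norm_sq] at h1
  have h4 : s * (s * ⟪T (T x), T x⟫) ≤ s * ‖T x‖ ^ 2 := by
    have := mul_le_mul_of_nonneg_left h3 hs0.le
    rw [← mul_assoc, hsT, one_mul] at this
    gcongr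
  have h5 : s * ‖T x‖ ^ 2 ≤ ⟪T x, x⟫ := by linarith
  calc ‖T x‖ ^ 2 = ‖T‖ * (s * ‖T x‖ ^ 2) := by rw [← mul_assoc, mul_comm ‖T‖, hsT, one_mul]
    _ ≤ _ := by gcongr

/-- A positive operator has vectors whose Rayleigh quotient exceeds any number below the norm. -/
theorem IsPositive.exists_lt_inner {T : E →L[ℝ] E} (hT : T.IsPositive) {a : ℝ} (ha : 0 ≤ a)
    (haT : a < ‖T‖) : ∃ x, a * ‖x‖ ^ 2 < ⟪T x, x⟫ := by
  by_contra! h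
  have hT0 : 0 < ‖T‖ := ha.trans_lt haT
  have h1 : ‖T‖ ≤ √(‖T‖ * a) := by
    refine T.opNorm_le_bound (Real.sqrt_nonneg _) fun x => ?_
    refine le_of_sq_le_sq ?_ (by positivity)
    rw [mul_pow, Real.sq_sqrt (by positivity)]
    calc ‖T x‖ ^ 2 ≤ ‖T‖ * ⟪T x, x⟫ := IsPositive.norm_apply_sq_le hT x
      _ ≤ ‖T‖ * (a * ‖x‖ ^ 2) := by gcongr; exact h x
      _ = _ := by ring
  have h2 : ‖T‖ ^ 2 ≤ ‖T‖ * a := by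
    rw [← Real.sq_sqrt (show 0 ≤ ‖T‖ * a by positivity)]
    gcongr
  nlinarith

theorem exists_norm_le_of_isUnit {X : Type*} [NormedAddCommGroup X] [NormedSpace ℝ X]
    {S : X →L[ℝ] X} (hS : IsUnit S) : ∃ c > 0, ∀ x, c * ‖x‖ ≤ ‖S x‖ := by
  obtain ⟨u, rfl⟩ := hS
  refine ⟨(‖(↑u⁻¹ : X →L[ℝ] X)‖ + 1)⁻¹, by positivity, fun x => ?_⟩
  rw [inv_mul_le_iff₀ (by positivity)]
  have h1 : (↑u⁻¹ : X →L[ℝ] X) ((u : X →L[ℝ] X) x) = x := by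
    rw [← mul_apply_eq_comp, Units.inv_mul, one_apply_eq_self]
  calc ‖x‖ = ‖(↑u⁻¹ : X →L[ℝ] X) ((u : X →L[ℝ] X) x)‖ := by rw [h1]
    _ ≤ ‖(↑u⁻¹ : X →L[ℝ] X)‖ * ‖(u : X →L[ℝ] X) x‖ := ContinuousLinearMap.le_opNorm _ _
    _ ≤ _ := by gcongr; linarith

/-- If `‖T‖ - T` were invertible it would be bounded below in norm; being positive, it would then be
bounded below as a quadratic form by `norm_apply_sq_le`. That would keep the Rayleigh quotients of
`T` away from `‖T‖`. -/
theorem IsPositive.norm_mem_spectrum {T : E →L[ℝ] E} (hT : T.IsPositive) (h0 : T ≠ 0) :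
    ‖T‖ ∈ spectrum ℝ T := by
  rw [spectrum.mem_iff]
  intro hu
  obtain ⟨c, hc, hcx⟩ := exists_norm_le_of_isUnit hu
  set S : E →L[ℝ] E := algebraMap ℝ (E →L[ℝ] E) ‖T‖ - T with hS
  have hSx : ∀ x, S x = ‖T‖ • x - T x := fun x => by
    simp [hS, Algebra.algebraMap_eq_smul_one]
  have hSq : ∀ x, ⟪S x, x⟫ = ‖T‖ * ‖x‖ ^ 2 - ⟪T x, x⟫ := fun x => by
    rw [hSx, inner_sub_left, real_inner_smul_left, real_inner_self_eq_norm_sq]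
  have hSpos : S.IsPositive := by
    refine ⟨fun x y => ?_, fun x => ?_⟩
    · change ⟪S x, y⟫ = ⟪x, S y⟫
      rw [hSx, hSx, inner_sub_left, inner_sub_right, real_inner_smul_left, real_inner_smul_right,
        hT.inner_left_eq_inner_right]
    · change 0 ≤ ⟪S x, x⟫
      rw [hSq]
      have : ⟪T x, x⟫ ≤ ‖T‖ * ‖x‖ * ‖x‖ :=
        (real_inner_le_norm _ _).trans (by gcongr; exact T.le_opNorm _)
      nlinarith
  have hTn : 0 < ‖T‖ := norm_pos_iff.2 h0
  set b : ℝ := c ^ 2 / (‖S‖ + 1) with hb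
  have hb0 : 0 < b := by positivity
  have key : ∀ x, b * ‖x‖ ^ 2 ≤ ⟪S x, x⟫ := fun x => by
    have h1 := IsPositive.norm_apply_sq_le hSpos x
    have h2 : (c * ‖x‖) ^ 2 ≤ ‖S x‖ ^ 2 := by gcongr; exact hcx x
    have h3 := IsPositive.inner_nonneg hSpos x
    rw [hb, div_mul_eq_mul_div, div_le_iff₀ (by positivity)]
    nlinarith
  obtain ⟨x, hx⟩ := IsPositive.exists_lt_inner hT (a := max 0 (‖T‖ - b)) (le_max_left _ _)
    (max_lt hTn (by linarith))
  have h1 := key x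
  have h2 : (‖T‖ - b) * ‖x‖ ^ 2 ≤ max 0 (‖T‖ - b) * ‖x‖ ^ 2 := by
    gcongr; exact le_max_right _ _
  rw [hSq] at h1
  linarith

theorem norm_sub_smul_sq (T : E →L[ℝ] E) (t : ℝ) (x : E) :
    ‖x - t • T x‖ ^ 2 = ‖x‖ ^ 2 - 2 * t * ⟪T x, x⟫ + t ^ 2 * ‖T x‖ ^ 2 := by
  rw [norm_sub_sq_real, real_inner_smul_right, norm_smul, mul_pow, Real.norm_eq_abs, sq_abs,
    real_inner_comm]
  ring

/-- `1 - t T` contracts on vectors on which a positive operator `T` is bounded below. -/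
theorem IsPositive.norm_sub_smul_sq_le {T : E →L[ℝ] E} (hT : T.IsPositive) {t m : ℝ} (ht : 0 ≤ t)
    (htT : t * ‖T‖ ≤ 2) {x : E} (hx : m * ‖x‖ ^ 2 ≤ ⟪T x, x⟫) :
    ‖x - t • T x‖ ^ 2 ≤ (1 - t * (2 - t * ‖T‖) * m) * ‖x‖ ^ 2 := by
  rw [norm_sub_smul_sq]
  have h1 := mul_le_mul_of_nonneg_left (IsPositive.norm_apply_sq_le hT x) (sq_nonneg t)
  have h2 := mul_le_mul_of_nonneg_left hx (mul_nonneg ht (sub_nonneg.2 htT))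
  nlinarith

/-- If `t ‖T‖ ≥ 2`, then `1 - t T` has norm `t ‖T‖ - 1`. -/
theorem IsPositive.norm_one_sub_smul {T : E →L[ℝ] E} (hT : T.IsPositive) {t : ℝ} (ht : 0 ≤ t)
    (htT : 2 ≤ t * ‖T‖) : ‖1 - t • T‖ = t * ‖T‖ - 1 := by
  apply le_antisymm
  · refine ContinuousLinearMap.opNorm_le_bound _ (by linarith) fun x => ?_
    refine le_of_sq_le_sq ?_ (mul_nonneg (by linarith) (norm_nonneg _))
    have h0 : (1 - t • T) x = x - t • T x := by simp
    rw [h0, norm_sub_smul_sq]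
    have h1 := mul_le_mul_of_nonneg_left (IsPositive.norm_apply_sq_le hT x) (sq_nonneg t)
    have h2 : ⟪T x, x⟫ ≤ ‖T‖ * ‖x‖ * ‖x‖ :=
      (real_inner_le_norm _ _).trans (by gcongr; exact T.le_opNorm _)
    have h3 := mul_le_mul_of_nonneg_left h2 (mul_nonneg ht (sub_nonneg.2 htT))
    nlinarith
  · have h1 : ‖t • T‖ ≤ ‖1 - t • T‖ + ‖(1 : E →L[ℝ] E)‖ := by
      rw [norm_sub_rev]; simpa using norm_add_le (t • T - 1) 1
    have h2 : ‖(1 : E →L[ℝ] E)‖ ≤ 1 := ContinuousLinearMap.norm_id_le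
    rw [norm_smul, Real.norm_of_nonneg ht] at h1
    linarith

end PositiveOperators

/-! ### Unstable fixed points with a symmetric linear part -/

section Instability

/-- Symmetry and Cauchy–Schwarz make `n ↦ ‖(D ^ n) x‖` log-convex, so the growth ratio of the first
step persists. A nearly maximal vector thus keeps growing at nearly the full rate. -/
theorem norm_apply_pow_le {E : Type*} [NormedAddCommGroup E] [InnerProductSpace ℝ E]
    {D : E →L[ℝ] E} (hD : D.IsSymmetric) {x : E} (hx : ‖x‖ = 1) (n : ℕ) :
    ‖D x‖ ^ n ≤ ‖(D ^ n) x‖ := by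
  have hpow : ∀ n, (D ^ (n + 1)) x = D ((D ^ n) x) := fun n => by
    rw [pow_succ', mul_apply_eq_comp]
  have hconv : ∀ n, ‖(D ^ (n + 1)) x‖ ^ 2 ≤ ‖(D ^ n) x‖ * ‖(D ^ (n + 2)) x‖ := fun n => by
    rw [← real_inner_self_eq_norm_sq]
    calc ⟪(D ^ (n + 1)) x, (D ^ (n + 1)) x⟫ = ⟪(D ^ n) x, (D ^ (n + 2)) x⟫ := by
          rw [hpow (n + 1)]
          nth_rewrite 1 [hpow n]
          exact hD _ _
      _ ≤ _ := real_inner_le_norm _ _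
  have hmono : ∀ n, ‖D x‖ * ‖(D ^ n) x‖ ≤ ‖(D ^ (n + 1)) x‖ := by
    intro n
    induction n with
    | zero => simp [hx]
    | succ n ih =>
      rcases (norm_nonneg ((D ^ n) x)).eq_or_lt with h0 | h0
      · have h1 := hconv n
        rw [← h0, zero_mul] at h1
        have h2 : ‖(D ^ (n + 1)) x‖ = 0 := by
          have := norm_nonneg ((D ^ (n + 1)) x)
          nlinarith
        rw [h2, mul_zero]
        exact norm_nonneg _
      · have h1 := hconv n
        have h2 := mul_le_mul_of_nonneg_right ih (norm_nonneg ((D ^ (n + 1)) x))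
        refine le_of_mul_le_mul_left ?_ h0
        calc _ = ‖D x‖ * ‖(D ^ n) x‖ * ‖(D ^ (n + 1)) x‖ := by ring
          _ ≤ ‖(D ^ (n + 1)) x‖ ^ 2 := by rw [sq]; exact h2
          _ ≤ _ := h1
  induction n with
  | zero => simp [hx]
  | succ n ih =>
    calc ‖D x‖ ^ (n + 1) = ‖D x‖ * ‖D x‖ ^ n := pow_succ' _ _
      _ ≤ ‖D x‖ * ‖(D ^ n) x‖ := by gcongr
      _ ≤ _ := hmono n

theorem exists_norm_eq_one_lt_norm_apply {E : Type*} [NormedAddCommGroup E] [NormedSpace ℝ E]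
    {D : E →L[ℝ] E} {s : ℝ} (hs : 0 ≤ s) (hsD : s < ‖D‖) : ∃ x, ‖x‖ = 1 ∧ s < ‖D x‖ := by
  by_contra! h
  refine hsD.not_ge (D.opNorm_le_bound hs fun x => ?_)
  rcases eq_or_ne x 0 with rfl | hx
  · simp
  have hx' : 0 < ‖x‖ := norm_pos_iff.2 hx
  have h1 := h (‖x‖⁻¹ • x) (by rw [norm_smul, norm_inv, norm_norm, inv_mul_cancel₀ hx'.ne'])
  rw [map_smul, norm_smul, norm_inv, norm_norm, inv_mul_le_iff₀ hx'] at h1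
  linarith

/-- A fixed point at which a map has a quadratic remainder over a symmetric linear part of norm
greater than one is unstable. -/
theorem exists_iterate_dist_ge {E : Type*} [NormedAddCommGroup E] [InnerProductSpace ℝ E]
    {F : E → E} {p : E} {D : E →L[ℝ] E} (hD : D.IsSymmetric) (hD1 : 1 < ‖D‖)
    (hF : (fun z => F z - p - D (z - p)) =O[𝓝 p] fun z => ‖z - p‖ ^ 2) :
    ∃ ε > 0, ∀ δ > 0, ∃ z₀, dist z₀ p < δ ∧ ∃ n : ℕ, ε ≤ dist (F^[n] z₀) p := by
  obtain ⟨C, hC, hFC⟩ := hF.exists_pos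
  obtain ⟨ρ, hρ, hFρ⟩ := Metric.eventually_nhds_iff.1 hFC.bound
  set r := ‖D‖ with hr
  have hr0 : 0 < r := by linarith
  have hrr : 0 < r ^ 2 - r := by nlinarith
  -- `K` solves `r K + 4 C = K r ^ 2`: old errors grow by at most `r`, the new one is at most `C (2
  -- q) ^ 2` with `q = d r ^ n`, and the bound `K q ^ 2` grows by `r ^ 2`.
  set K := 4 * C / (r ^ 2 - r) with hK
  have hK0 : 0 < K := by positivity
  have hKr : r * K + 4 * C = K * r ^ 2 := by
    have h := div_mul_cancel₀ (4 * C) hrr.ne'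
    rw [← hK] at h
    linarith
  obtain ⟨a, ha0, haρ, haK⟩ : ∃ a > 0, 2 * a < ρ ∧ K * a ≤ 1 / 2 := by
    refine ⟨min (ρ / 4) (1 / (2 * K)), by positivity, ?_, ?_⟩
    · linarith [min_le_left (ρ / 4) (1 / (2 * K))]
    · calc K * min (ρ / 4) (1 / (2 * K)) ≤ K * (1 / (2 * K)) := by gcongr; exact min_le_right _ _
        _ = 1 / 2 := by field_simp
  refine ⟨a / (4 * r), by positivity, fun δ hδ => ?_⟩
  set d := min (δ / 2) a with hd
  have hd0 : 0 < d := by positivity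
  obtain ⟨N, hN1, hN2⟩ := exists_nat_pow_near (x := a / d) (y := r)
    ((one_le_div hd0).2 (min_le_right _ _)) hD1
  rw [le_div_iff₀ hd0] at hN1
  rw [div_lt_iff₀ hd0] at hN2
  -- The number of steps `N` is fixed before the direction, so `s` may be taken close enough to `r`
  -- to lose only a quarter over `N` steps. The nonlinear error costs another half, leaving the
  -- quarter of `a / r` that is the escape radius.
  obtain ⟨s, hs0, hsr, hsN⟩ : ∃ s, 0 ≤ s ∧ s < r ∧ 3 / 4 * r ^ N ≤ s ^ N := by
    have h1 : ∀ᶠ s in 𝓝[<] r, 3 / 4 * r ^ N < s ^ N := by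
      have : Tendsto (fun s : ℝ => s ^ N) (𝓝[<] r) (𝓝 (r ^ N)) :=
        ((continuous_pow N).tendsto r).mono_left nhdsWithin_le_nhds
      exact this.eventually (lt_mem_nhds (by nlinarith [pow_pos hr0 N]))
    have h2 : ∀ᶠ s in 𝓝[<] r, 0 < s :=
      nhdsWithin_le_nhds (lt_mem_nhds hr0)
    obtain ⟨s, hs⟩ := (h1.and (h2.and self_mem_nhdsWithin)).exists
    exact ⟨s, hs.2.1.le, hs.2.2, hs.1.le⟩
  obtain ⟨x, hx1, hxs⟩ := exists_norm_eq_one_lt_norm_apply hs0 hsr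
  have hxN : 3 / 4 * r ^ N ≤ ‖(D ^ N) x‖ :=
    (hsN.trans (by gcongr)).trans (norm_apply_pow_le hD hx1 N)
  have hDn : ∀ n, ‖(D ^ n) x‖ ≤ r ^ n := by
    intro n
    induction n with
    | zero => simp [hx1]
    | succ n ih =>
      rw [pow_succ', pow_succ', mul_apply_eq_comp]
      exact (D.le_opNorm _).trans (by gcongr)
  set z₀ := p + d • x with hz₀
  have hz₀d : dist z₀ p = d := by
    rw [hz₀, dist_eq_norm, add_sub_cancel_left, norm_smul, hx1, Real.norm_of_nonneg hd0.le, mul_one]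
  have hmain : ∀ n ≤ N, ‖F^[n] z₀ - p - d • (D ^ n) x‖ ≤ K * (d * r ^ n) ^ 2 := by
    intro n
    induction n with
    | zero => intro _; simp [hz₀]; positivity
    | succ n ih =>
      intro hn
      have ih := ih (by omega)
      have hpn : d * r ^ n ≤ a := by
        refine le_trans ?_ hN1
        rw [mul_comm]
        gcongr
        · exact hD1.le
        · omega
      have hq0 : 0 < d * r ^ n := by positivity
      set q := d * r ^ n with hq
      have h1 : ‖F^[n] z₀ - p‖ ≤ 2 * q := by
        calc ‖F^[n] z₀ - p‖ = ‖(F^[n] z₀ - p - d • (D ^ n) x) + d • (D ^ n) x‖ := by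
              rw [sub_add_cancel]
          _ ≤ K * q ^ 2 + d * r ^ n := by
              refine (norm_add_le _ _).trans (add_le_add ih ?_)
              rw [norm_smul, Real.norm_of_nonneg hd0.le]
              gcongr
              exact hDn n
          _ ≤ 2 * q := by
              have : K * q ≤ 1 / 2 := le_trans (by gcongr) haK
              nlinarith
      have h2 := hFρ (y := F^[n] z₀) (by rw [dist_eq_norm]; linarith)
      rw [Real.norm_of_nonneg (by positivity)] at h2
      have h3 : F^[n + 1] z₀ - p - d • (D ^ (n + 1)) x =
          (F (F^[n] z₀) - p - D (F^[n] z₀ - p)) + D (F^[n] z₀ - p - d • (D ^ n) x) := by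
        rw [Function.iterate_succ_apply', pow_succ', mul_apply_eq_comp,
          map_sub D (F^[n] z₀ - p), map_smul]
        abel
      rw [h3]
      calc _ ≤ C * (2 * q) ^ 2 + r * (K * q ^ 2) := by
            refine (norm_add_le _ _).trans (add_le_add (h2.trans (by gcongr)) ?_)
            exact (D.le_opNorm _).trans (by gcongr)
        _ = (r * K + 4 * C) * q ^ 2 := by ring
        _ = K * (d * r ^ (n + 1)) ^ 2 := by rw [hKr, hq]; ring
  refine ⟨z₀, ?_, N, ?_⟩
  · rw [hz₀d]; linarith [min_le_left (δ / 2) a]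
  · have h1 := hmain N le_rfl
    have h2 : ‖d • (D ^ N) x‖ ≤ ‖F^[N] z₀ - p - d • (D ^ N) x‖ + ‖F^[N] z₀ - p‖ := by
      have := norm_sub_le (F^[N] z₀ - p) (F^[N] z₀ - p - d • (D ^ N) x)
      rw [sub_sub_cancel] at this
      linarith
    rw [norm_smul, Real.norm_of_nonneg hd0.le] at h2
    have h3 : d * (3 / 4 * r ^ N) ≤ d * ‖(D ^ N) x‖ := by gcongr
    have h4 : 0 < d * r ^ N := by positivity
    have h5 : K * (d * r ^ N) ≤ 1 / 2 := le_trans (by gcongr; linarith) haK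
    have h6 : K * (d * r ^ N) ^ 2 ≤ 1 / 2 * (d * r ^ N) := by
      rw [sq, ← mul_assoc]; gcongr
    have h7 : a / r < d * r ^ N := by
      rw [div_lt_iff₀ hr0]; calc a < _ := hN2
        _ = _ := by ring
    rw [dist_eq_norm, show a / (4 * r) = a / r / 4 by field_simp]
    linarith

theorem HasStrictFDerivAt.exists_ball_norm_sub_le {X Y : Type*} [NormedAddCommGroup X]
    [NormedSpace ℝ X] [NormedAddCommGroup Y] [NormedSpace ℝ Y] {F : X → Y} {F' : X →L[ℝ] Y} {p : X}
    (hF : HasStrictFDerivAt F F' p) {η : ℝ} (hη : 0 < η) :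
    ∃ ε > 0, ∀ x y, dist x p < ε → dist y p < ε → ‖F x - F y - F' (x - y)‖ ≤ η * ‖x - y‖ := by
  obtain ⟨ε, hε, h⟩ := Metric.eventually_nhds_iff.1 (hF.isLittleO.def hη)
  exact ⟨ε, hε, fun x y hx hy => h (y := (x, y)) (max_lt hx hy)⟩

/-- If a quadratic form is expanded by the derivative at `p`, uniformly, then a dense set of
points leaves a neighbourhood of `p`. -/
theorem dense_exists_iterate_dist_ge {E : Type*} [NormedAddCommGroup E] [InnerProductSpace ℝ E]
    {F : E → E} {p : E} {D S : E →L[ℝ] E} (hF : HasStrictFDerivAt F D p) {c g : ℝ}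
    (hc : 0 < c) (hg : 1 < g)
    (hS : ∀ x, c * ‖x‖ ^ 2 + g * ⟪S x, x⟫ ≤ ⟪S (D x), D x⟫) {x₀ : E} (hx₀ : 0 < ⟪S x₀, x₀⟫) :
    ∃ ε > 0, Dense {z₀ | ∃ n : ℕ, ε ≤ dist (F^[n] z₀) p} := by
  -- The nonlinear error `η ‖w‖` changes the quadratic form by at most this multiple of `‖w‖ ^ 2`,
  -- which the surplus `c ‖w‖ ^ 2` absorbs.
  obtain ⟨η, hη, hηc⟩ : ∃ η > 0, ‖S‖ * (2 * ‖D‖ * η + η ^ 2) < c := by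
    have h1 : Tendsto (fun η : ℝ => ‖S‖ * (2 * ‖D‖ * η + η ^ 2)) (𝓝[>] 0) (𝓝 0) := by
      have : Continuous fun η : ℝ => ‖S‖ * (2 * ‖D‖ * η + η ^ 2) := by fun_prop
      simpa using (this.tendsto 0).mono_left nhdsWithin_le_nhds
    obtain ⟨η, h2⟩ := ((h1.eventually (gt_mem_nhds hc)).and self_mem_nhdsWithin).exists
    exact ⟨η, h2.2, h2.1⟩
  obtain ⟨ε, hε, hFε⟩ := HasStrictFDerivAt.exists_ball_norm_sub_le hF hη
  have hle : ∀ x y : E, |⟪S x, y⟫| ≤ ‖S‖ * ‖x‖ * ‖y‖ := fun x y =>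
    (abs_real_inner_le_norm _ _).trans (by gcongr; exact S.le_opNorm x)
  have hstep : ∀ x y, dist x p < ε → dist y p < ε →
      g * ⟪S (x - y), x - y⟫ ≤ ⟪S (F x - F y), F x - F y⟫ := by
    intro x y hx hy
    set w := x - y
    set e := F x - F y - D w with he
    have h0 : F x - F y = D w + e := by rw [he]; abel
    have h1 : ‖e‖ ≤ η * ‖w‖ := hFε x y hx hy
    have h2 : ‖D w‖ ≤ ‖D‖ * ‖w‖ := D.le_opNorm w
    rw [h0, map_add, inner_add_left, inner_add_right, inner_add_right]
    have h3 := hS w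
    have h4 := (abs_le.1 (hle (D w) e)).1
    have h5 := (abs_le.1 (hle e (D w))).1
    have h6 := (abs_le.1 (hle e e)).1
    have h7 : ‖S‖ * ‖D w‖ * ‖e‖ ≤ ‖S‖ * (‖D‖ * ‖w‖) * (η * ‖w‖) := by gcongr
    have h8 : ‖S‖ * ‖e‖ * ‖e‖ ≤ ‖S‖ * (η * ‖w‖) * (η * ‖w‖) := by gcongr
    have h9 := mul_le_mul_of_nonneg_right hηc.le (sq_nonneg ‖w‖)
    nlinarith
  refine ⟨ε, hε, ?_⟩
  rw [← compl_compl {z₀ | ∃ n : ℕ, ε ≤ dist (F^[n] z₀) p}, ← interior_eq_empty_iff_dense_compl,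
    Set.eq_empty_iff_forall_notMem]
  intro z hz
  have hzn : ∀ y ∈ interior {z₀ | ∃ n : ℕ, ε ≤ dist (F^[n] z₀) p}ᶜ, ∀ n, dist (F^[n] y) p < ε := by
    intro y hy n
    have := interior_subset hy
    simp only [Set.mem_compl_iff, Set.mem_ofPred_eq, not_exists, not_le] at this
    exact this n
  -- Were there an open set of orbits that stay close, it would contain two starting points
  -- differing by a multiple of `x₀`; the form on their difference would grow like `g ^ n` and yet
  -- stay bounded.
  obtain ⟨t, ht, htz⟩ : ∃ t > (0 : ℝ), z + t • x₀ ∈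
      interior {z₀ | ∃ n : ℕ, ε ≤ dist (F^[n] z₀) p}ᶜ := by
    have h1 : Tendsto (fun t : ℝ => z + t • x₀) (𝓝[>] 0) (𝓝 z) := by
      have : Continuous fun t : ℝ => z + t • x₀ := by fun_prop
      simpa using (this.tendsto 0).mono_left nhdsWithin_le_nhds
    obtain ⟨t, h2⟩ := ((h1.eventually (isOpen_interior.mem_nhds hz)).and self_mem_nhdsWithin).exists
    exact ⟨t, h2.2, h2.1⟩
  have h1 := hzn _ hz
  have h2 := hzn _ htz
  have hgrow : ∀ n, g ^ n * (t ^ 2 * ⟪S x₀, x₀⟫) ≤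
      ⟪S (F^[n] (z + t • x₀) - F^[n] z), F^[n] (z + t • x₀) - F^[n] z⟫ := by
    intro n
    induction n with
    | zero =>
      simp only [pow_zero, one_mul, Function.iterate_zero, id, add_sub_cancel_left, map_smul,
        real_inner_smul_left, real_inner_smul_right]
      apply le_of_eq; ring
    | succ n ih =>
      rw [Function.iterate_succ_apply', Function.iterate_succ_apply']
      refine le_trans ?_ (hstep _ _ (h2 n) (h1 n))
      rw [pow_succ', mul_assoc]
      gcongr
  have hbdd : ∀ n, g ^ n * (t ^ 2 * ⟪S x₀, x₀⟫) ≤ ‖S‖ * (2 * ε) * (2 * ε) := by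
    intro n
    have h3 : ‖F^[n] (z + t • x₀) - F^[n] z‖ ≤ 2 * ε := by
      rw [← dist_eq_norm]
      have := dist_triangle_right (F^[n] (z + t • x₀)) (F^[n] z) p
      linarith [h1 n, h2 n]
    refine (hgrow n).trans ((le_abs_self _).trans ((hle _ _).trans ?_))
    gcongr
  have h4 : Tendsto (fun n : ℕ => g ^ n * (t ^ 2 * ⟪S x₀, x₀⟫)) atTop atTop :=
    (tendsto_pow_atTop_atTop_of_one_lt hg).atTop_mul_const (by positivity)
  obtain ⟨n, hn⟩ := (h4.eventually_gt_atTop (‖S‖ * (2 * ε) * (2 * ε))).exists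
  exact (hbdd n).not_gt hn

end Instability

/-! ### Convergence to a family of fixed points -/

section Convergence

variable {E C : Type*} [NormedAddCommGroup E] [NormedSpace ℝ E] [NormedAddCommGroup C]
  [NormedSpace ℝ C] [FiniteDimensional ℝ C]

/-- A family whose derivative has range `K` can be reparametrized near the base point by its
projection to `K`. -/
theorem exists_local_section {K : Submodule ℝ E} {p : E} {Φ : C → E} {Φ' : C →L[ℝ] E} {c₀ : C}
    (hΦ : HasStrictFDerivAt Φ Φ' c₀) (hΦ₀ : Φ c₀ = p) (P : E →L[ℝ] K) (hP : ∀ k : K, P k = k)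
    (hK : (Φ' : C →ₗ[ℝ] E).range = K) :
    ∃ σ : K → C, σ 0 = c₀ ∧ ContinuousAt σ 0 ∧ (∀ᶠ k in 𝓝 0, P (Φ (σ k) - p) = k) ∧
      ∃ L : NNReal, ∃ s ∈ 𝓝 (0 : K), LipschitzOnWith L (fun k => Φ (σ k)) s := by
  have : FiniteDimensional ℝ K := by subst hK; infer_instance
  have hmem : ∀ c, (Φ' : C →ₗ[ℝ] E) c ∈ K := fun c => hK ▸ LinearMap.mem_range_self _ c
  -- The parameters may be redundant, so `Φ'` need not be injective. A linear right inverse onto `K`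
  -- selects a slice on which the projected family has derivative the identity, and the inverse
  -- function theorem applies.
  obtain ⟨J, hJ⟩ := LinearMap.exists_rightInverse_of_surjective
    ((Φ' : C →ₗ[ℝ] E).codRestrict K hmem) (by
      rw [LinearMap.range_eq_top]
      rintro ⟨k, hk⟩
      rw [← hK] at hk
      obtain ⟨c, rfl⟩ := hk
      exact ⟨c, rfl⟩)
  have hJk : ∀ k, Φ' (J k) = k := fun k => congrArg Subtype.val (LinearMap.congr_fun hJ k)
  set J' : K →L[ℝ] C := J.toContinuousLinearMap with hJ'
  have hγ : HasStrictFDerivAt (fun k : K => c₀ + J' k) J' 0 :=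
    J'.hasStrictFDerivAt.const_add c₀
  have hΦγ : HasStrictFDerivAt (fun k : K => Φ (c₀ + J' k)) (Φ' ∘L J') 0 :=
    HasStrictFDerivAt.comp (0 : K) (by simpa using hΦ) hγ
  have hh : HasStrictFDerivAt (fun k : K => P (Φ (c₀ + J' k) - p))
      ((ContinuousLinearEquiv.refl ℝ K : K ≃L[ℝ] K) : K →L[ℝ] K) 0 := by
    have h1 := P.hasStrictFDerivAt.comp (0 : K) (hΦγ.sub_const p)
    refine h1.congr_fderiv ?_
    ext k
    simp [hJ', hJk, hP]
  have hh0 : P (Φ (c₀ + J' 0) - p) = 0 := by simp [hΦ₀]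
  set g := hh.localInverse _ _ _ with hg
  have hg0 : g 0 = 0 := by
    have := hh.localInverse_apply_image
    rwa [hh0] at this
  have hgd : HasStrictFDerivAt g
      ((ContinuousLinearEquiv.refl ℝ K : K ≃L[ℝ] K).symm : K →L[ℝ] K) 0 := by
    have := hh.to_localInverse
    rwa [hh0] at this
  have hgr : ∀ᶠ k in 𝓝 0, P (Φ (c₀ + J' (g k)) - p) = k := by
    have := hh.eventually_right_inverse
    rwa [hh0] at this
  refine ⟨fun k => c₀ + J' (g k), by simp [hg0], ?_, hgr, ?_⟩
  · exact (continuousAt_const).add (J'.continuous.continuousAt.comp hgd.continuousAt)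
  · have : HasStrictFDerivAt (fun k => Φ (c₀ + J' (g k))) ((Φ' ∘L J') ∘L
        ((ContinuousLinearEquiv.refl ℝ K : K ≃L[ℝ] K).symm : K →L[ℝ] K)) 0 :=
      HasStrictFDerivAt.comp (g := fun k : K => Φ (c₀ + J' k)) (0 : K) (by rw [hg0]; exact hΦγ) hgd
    exact this.exists_lipschitzOnWith

/-- Iterates of a map starting near a fixed point converge to a nearby fixed point, if the
derivative is a contraction transversally to a family of fixed points. -/
theorem eventually_exists_tendsto_iterate {K : Submodule ℝ E} {F : E → E} {p : E} {D : E →L[ℝ] E}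
    (hF : HasStrictFDerivAt F D p) {Φ : C → E} {Φ' : C →L[ℝ] E} {c₀ : C}
    (hΦ : HasStrictFDerivAt Φ Φ' c₀) (hΦ₀ : Φ c₀ = p) (hfix : ∀ᶠ c in 𝓝 c₀, F (Φ c) = Φ c)
    (P : E →L[ℝ] K) (hP : ∀ k : K, P k = k) (hPD : ∀ x, P (D x) = P x)
    (hK : (Φ' : C →ₗ[ℝ] E).range = K) {θ : ℝ} (hθ₀ : 0 ≤ θ) (hθ₁ : θ < 1)
    (hD : ∀ x, P x = 0 → ‖D x‖ ≤ θ * ‖x‖) {N : Set C} (hN : N ∈ 𝓝 c₀) :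
    ∀ᶠ z in 𝓝 p, ∃ c ∈ N, Tendsto (fun n => F^[n] z) atTop (𝓝 (Φ c)) := by
  have : FiniteDimensional ℝ K := by subst hK; infer_instance
  have : CompleteSpace K := FiniteDimensional.complete ℝ K
  obtain ⟨σ, hσ0, hσc, hσP, L, s, hs, hL⟩ := exists_local_section hΦ hΦ₀ P hP hK
  set Ψ : K → E := fun k => Φ (σ k) with hΨ
  have hΨ0 : Ψ 0 = p := by simp [hΨ, hσ0, hΦ₀]
  have hσt : Tendsto σ (𝓝 0) (𝓝 c₀) := by rw [← hσ0]; exact hσc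
  have hΨc : ContinuousAt Ψ 0 := hL.continuousOn.continuousAt hs
  set q := (1 + θ) / 2 with hq
  have hq0 : 0 < q := by positivity
  have hq1 : q < 1 := by rw [hq]; linarith
  set A := 1 + L * ‖P‖ with hA
  have hA0 : 0 < A := by positivity
  -- Chosen so that `θ + η A = q < 1`; the term `L ‖P‖` in `A` pays for the motion of the base point
  -- `Ψ (k z)` on the family.
  set η := (1 - θ) / 2 / A with hη
  have hη0 : 0 < η := by have : 0 < 1 - θ := by linarith
                         positivity
  have hηA : θ + η * A = q := by
    rw [hη, div_mul_cancel₀ _ hA0.ne', hq]; ring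
  obtain ⟨b, hb, hFb⟩ := HasStrictFDerivAt.exists_ball_norm_sub_le hF hη0
  have hev : ∀ᶠ k in 𝓝 (0 : K), k ∈ s ∧ P (Ψ k - p) = k ∧ F (Ψ k) = Ψ k ∧ σ k ∈ N ∧
      dist (Ψ k) p < b / 2 := by
    refine (Filter.eventually_mem_set.2 hs).and (hσP.and ((hσt.eventually hfix).and
      ((hσt.eventually (Filter.eventually_mem_set.2 hN)).and ?_)))
    have := hΨc.tendsto
    rw [hΨ0] at this
    exact this.eventually (Metric.ball_mem_nhds p (half_pos hb))
  obtain ⟨a, ha, hka⟩ := Metric.eventually_nhds_iff.1 hev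
  simp only [dist_zero_right] at hka
  set κ := ‖P‖ * η with hκ
  have hκ0 : 0 ≤ κ := by positivity
  set k : E → K := fun z => P (z - p) with hk
  set w : E → E := fun z => z - Ψ (k z) with hw
  -- `β` solves `κ + β q = β`, which makes `‖k‖ + β ‖w‖` nonincreasing: drift along the family is
  -- paid for by decay towards it.
  set β := κ / (1 - q) with hβ
  have hβ0 : 0 ≤ β := div_nonneg hκ0 (by linarith)
  have hβq : κ + β * q = β := by
    have h1 : 1 - q ≠ 0 := by linarith
    have h2 : β * (1 - q) = κ := div_mul_cancel₀ _ h1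
    linarith
  have hstep : ∀ z, ‖k z‖ + β * ‖w z‖ < a / 2 → ‖w z‖ < b / 2 →
      ‖w (F z)‖ ≤ q * ‖w z‖ ∧ ‖k (F z) - k z‖ ≤ κ * ‖w z‖ ∧
        ‖k (F z)‖ + β * ‖w (F z)‖ < a / 2 ∧ ‖w (F z)‖ < b / 2 := by
    intro z h1 h2
    have hkz : ‖k z‖ < a / 2 := by
      have : 0 ≤ β * ‖w z‖ := by positivity
      linarith
    obtain ⟨hs1, hP1, hF1, -, hd1⟩ := hka (y := k z) (by linarith)
    have hzb : dist z p < b := by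
      calc dist z p ≤ dist z (Ψ (k z)) + dist (Ψ (k z)) p := dist_triangle _ _ _
        _ < b / 2 + b / 2 := by rw [dist_eq_norm]; exact add_lt_add h2 hd1
        _ = b := by ring
    have he := hFb z (Ψ (k z)) hzb (by linarith)
    rw [hF1] at he
    change ‖F z - Ψ (k z) - D (w z)‖ ≤ η * ‖w z‖ at he
    set e := F z - Ψ (k z) - D (w z) with hedef
    have hPw : P (w z) = 0 := by
      have : w z = (z - p) - (Ψ (k z) - p) := by simp [hw]
      rw [this, map_sub, hP1]
      exact sub_self _
    -- The linear part does not move the coordinate along the family, since `P ∘ D = P` and `P (w z)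
    -- = 0`; only the error `e` does.
    have hkk : k (F z) - k z = P e := by
      have h3 : F z - p = (Ψ (k z) - p) + D (w z) + e := by rw [hedef]; abel
      have h4 : k (F z) = P (F z - p) := rfl
      rw [h4, h3, map_add, map_add, hP1, hPD, hPw, add_zero, add_sub_cancel_left]
    have hkκ : ‖k (F z) - k z‖ ≤ κ * ‖w z‖ := by
      rw [hkk, hκ, mul_assoc]
      exact (P.le_opNorm e).trans (by gcongr)
    have hk' : ‖k (F z)‖ ≤ ‖k z‖ + κ * ‖w z‖ := by
      have := norm_add_le (k (F z) - k z) (k z)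
      rw [sub_add_cancel] at this
      linarith
    have hkβ : κ * ‖w z‖ ≤ β * ‖w z‖ := by
      have : κ ≤ β := by nlinarith
      gcongr
    obtain ⟨hs2, -⟩ := hka (y := k (F z)) (by linarith)
    have hΨL : ‖Ψ (k (F z)) - Ψ (k z)‖ ≤ L * (κ * ‖w z‖) := by
      have := hL.dist_le_mul _ hs2 _ hs1
      rw [dist_eq_norm, dist_eq_norm] at this
      exact this.trans (by gcongr)
    have hw' : ‖w (F z)‖ ≤ q * ‖w z‖ := by
      have h3 : w (F z) = D (w z) + e - (Ψ (k (F z)) - Ψ (k z)) := by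
        change F z - Ψ (k (F z)) = _
        rw [hedef]; abel
      rw [h3]
      calc _ ≤ θ * ‖w z‖ + η * ‖w z‖ + L * (κ * ‖w z‖) :=
            (norm_sub_le _ _).trans
              (add_le_add ((norm_add_le _ _).trans (add_le_add (hD _ hPw) he)) hΨL)
        _ = (θ + η * A) * ‖w z‖ := by rw [hA, hκ]; ring
        _ = q * ‖w z‖ := by rw [hηA]
    refine ⟨hw', hkκ, ?_, ?_⟩
    · have h5 : β * ‖w (F z)‖ ≤ β * (q * ‖w z‖) := by gcongr
      have h6 : κ * ‖w z‖ + β * (q * ‖w z‖) = β * ‖w z‖ := by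
        rw [← mul_assoc, ← add_mul, hβq]
      linarith
    · have : q * ‖w z‖ ≤ ‖w z‖ := mul_le_of_le_one_left (norm_nonneg _) hq1.le
      linarith
  have hkp : k p = 0 := by simp [hk]
  have hwp : w p = 0 := by simp [hw, hkp, hΨ0]
  have hkc : ContinuousAt k p := by
    have : Continuous k := by simp only [hk]; fun_prop
    exact this.continuousAt
  have hwc : ContinuousAt w p := by
    refine continuousAt_id.sub (ContinuousAt.comp (g := Ψ) ?_ hkc)
    rwa [hkp]
  have hstart : ∀ᶠ z in 𝓝 p, ‖k z‖ + β * ‖w z‖ < a / 2 ∧ ‖w z‖ < b / 2 := by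
    refine Filter.Eventually.and ?_ ?_
    · have : ContinuousAt (fun z => ‖k z‖ + β * ‖w z‖) p := hkc.norm.add (hwc.norm.const_mul β)
      refine this.eventually_lt continuousAt_const ?_
      simp [hkp, hwp, ha]
    · refine hwc.norm.eventually_lt continuousAt_const ?_
      simp [hwp, hb]
  filter_upwards [hstart] with z hz
  have hinv : ∀ n, ‖k (F^[n] z)‖ + β * ‖w (F^[n] z)‖ < a / 2 ∧ ‖w (F^[n] z)‖ < b / 2 ∧
      ‖w (F^[n] z)‖ ≤ ‖w z‖ * q ^ n := by
    intro n
    induction n with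
    | zero => simpa using hz
    | succ n ih =>
      rw [Function.iterate_succ_apply']
      obtain ⟨h1, -, h3, h4⟩ := hstep _ ih.1 ih.2.1
      refine ⟨h3, h4, h1.trans ?_⟩
      rw [pow_succ, ← mul_assoc, mul_comm _ q]
      gcongr
      exact ih.2.2
  have hcau : CauchySeq fun n => k (F^[n] z) := by
    refine cauchySeq_of_le_geometric q (κ * ‖w z‖) hq1 fun n => ?_
    obtain ⟨-, h2, -, -⟩ := hstep _ (hinv n).1 (hinv n).2.1
    rw [dist_comm, dist_eq_norm, Function.iterate_succ_apply']
    exact (h2.trans (mul_le_mul_of_nonneg_left (hinv n).2.2 hκ0)).trans_eq (by ring)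
  obtain ⟨k', hk'⟩ := cauchySeq_tendsto_of_complete hcau
  have hk'a : ‖k'‖ < a := by
    have : ‖k'‖ ≤ a / 2 := by
      refine le_of_tendsto hk'.norm (Eventually.of_forall fun n => ?_)
      have h1 := (hinv n).1
      have : 0 ≤ β * ‖w (F^[n] z)‖ := by positivity
      linarith
    linarith
  obtain ⟨-, -, -, hN', -⟩ := hka hk'a
  refine ⟨σ k', hN', ?_⟩
  have hw0 : Tendsto (fun n => w (F^[n] z)) atTop (𝓝 0) := by
    refine squeeze_zero_norm (fun n => (hinv n).2.2) ?_
    simpa using (tendsto_pow_atTop_nhds_zero_of_lt_one hq0.le hq1).const_mul ‖w z‖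
  have hsk' : s ∈ 𝓝 k' := by
    have : Metric.ball (0 : K) a ∈ 𝓝 k' := Metric.isOpen_ball.mem_nhds (by simpa using hk'a)
    refine mem_of_superset this fun y hy => (hka (by simpa using hy)).1
  have hΨk' : Tendsto (fun n => Ψ (k (F^[n] z))) atTop (𝓝 (Ψ k')) :=
    (hL.continuousOn.continuousAt hsk').tendsto.comp hk'
  have := hΨk'.add hw0
  rw [add_zero] at this
  refine this.congr fun n => ?_
  simp [hw]

end Convergence

/-! ### Maps with derivative `1 - t T`, with `T` positive -/

section LinearizedIteration

variable {E : Type*} [NormedAddCommGroup E] [InnerProductSpace ℝ E]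

/-- On the orthogonal complement of its kernel `R` is injective with the same closed range, so the
open mapping theorem bounds it below. -/
theorem exists_norm_le_of_isClosed_range [CompleteSpace E] {Z : Type*} [NormedAddCommGroup Z]
    [NormedSpace ℝ Z] [CompleteSpace Z] (R : E →L[ℝ] Z) (hR : IsClosed (Set.range R)) :
    ∃ c > 0, ∀ x ∈ ((R : E →ₗ[ℝ] Z).ker)ᗮ, c * ‖x‖ ≤ ‖R x‖ := by
  set K := (R : E →ₗ[ℝ] Z).ker with hK
  have hKc : IsClosed (K : Set E) := R.isClosed_ker
  have : CompleteSpace K := hKc.completeSpace_coe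
  set f : Kᗮ →L[ℝ] Z := R ∘L Kᗮ.subtypeL with hf
  have hinj : Function.Injective f := by
    rw [injective_iff_map_eq_zero]
    intro x hx
    have h1 : (x : E) ∈ K := hx
    have h2 := Submodule.inner_right_of_mem_orthogonal h1 x.2
    exact Subtype.ext (inner_self_eq_zero.1 h2)
  have hrange : Set.range f = Set.range R := by
    apply Set.Subset.antisymm
    · rintro _ ⟨x, rfl⟩
      exact ⟨x, rfl⟩
    · rintro _ ⟨x, rfl⟩
      refine ⟨⟨x - K.starProjection x, Submodule.sub_starProjection_mem_orthogonal x⟩, ?_⟩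
      have h1 : R (K.starProjection x) = 0 := K.starProjection_apply_mem x
      simp [hf, h1]
  obtain ⟨c, hc⟩ := f.antilipschitz_of_injective_of_isClosed_range hinj (hrange ▸ hR)
  refine ⟨((c : ℝ) + 1)⁻¹, by positivity, fun x hx => ?_⟩
  have h1 := hc.le_mul_norm (map_zero f) ⟨x, hx⟩
  rw [inv_mul_le_iff₀ (by positivity)]
  calc ‖x‖ ≤ c * ‖R x‖ := h1
    _ ≤ _ := by gcongr; linarith

/-- By symmetry `T` maps into `(ker T)ᗮ`, so the orthogonal projection onto `ker T` is invariant
under `1 - t T`; on `(ker T)ᗮ` the lower bound `m` gives a contraction. -/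
theorem IsPositive.eventually_exists_tendsto_iterate [CompleteSpace E] {C : Type*}
    [NormedAddCommGroup C] [NormedSpace ℝ C] [FiniteDimensional ℝ C] {T : E →L[ℝ] E}
    (hT : T.IsPositive) {t m : ℝ} (ht : 0 < t) (htT : t * ‖T‖ < 2) (hm : 0 < m)
    (hTm : ∀ x ∈ ((T : E →ₗ[ℝ] E).ker)ᗮ, m * ‖x‖ ^ 2 ≤ ⟪T x, x⟫) {F : E → E} {p : E}
    (hF : HasStrictFDerivAt F (1 - t • T) p) {Φ : C → E} {Φ' : C →L[ℝ] E} {c₀ : C}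
    (hΦ : HasStrictFDerivAt Φ Φ' c₀) (hΦ₀ : Φ c₀ = p) (hfix : ∀ᶠ c in 𝓝 c₀, F (Φ c) = Φ c)
    (hK : (Φ' : C →ₗ[ℝ] E).range = (T : E →ₗ[ℝ] E).ker) {N : Set C} (hN : N ∈ 𝓝 c₀) :
    ∀ᶠ z in 𝓝 p, ∃ c ∈ N, Tendsto (fun n => F^[n] z) atTop (𝓝 (Φ c)) := by
  set K := (T : E →ₗ[ℝ] E).ker with hKdef
  have : CompleteSpace K := T.isClosed_ker.completeSpace_coe
  set a := t * (2 - t * ‖T‖) * m with ha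
  have ha0 : 0 < a := mul_pos (mul_pos ht (by linarith)) hm
  -- The maximum matters only when `(ker T)ᗮ` is trivial, as `m` is then arbitrary and `1 - a` may
  -- be negative.
  refine SOMI.eventually_exists_tendsto_iterate (θ := √(max 0 (1 - a))) hF hΦ hΦ₀ hfix
    K.orthogonalProjectionOnto Submodule.orthogonalProjectionOnto_mem_subspace_eq_self ?_ hK
    (Real.sqrt_nonneg _) ?_ ?_ hN
  · intro x
    have h1 : K.orthogonalProjectionOnto (T x) = 0 := by
      rw [Submodule.orthogonalProjectionOnto_eq_zero_iff, Submodule.mem_orthogonal']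
      intro y hy
      rw [hT.inner_left_eq_inner_right, show T y = 0 from hy, inner_zero_right]
    simp [h1]
  · rw [Real.sqrt_lt' one_pos]
    exact max_lt (by norm_num) (by linarith)
  · intro x hx
    rw [Submodule.orthogonalProjectionOnto_eq_zero_iff] at hx
    have h1 := IsPositive.norm_sub_smul_sq_le hT ht.le htT.le (hTm x hx)
    have h2 : (1 - t • T) x = x - t • T x := by simp
    rw [h2]
    refine le_of_sq_le_sq ?_ (by positivity)
    rw [mul_pow, Real.sq_sqrt (le_max_left _ _)]
    refine h1.trans ?_
    gcongr
    exact le_max_right _ _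

theorem IsPositive.exists_iterate_dist_ge {T : E →L[ℝ] E} (hT : T.IsPositive) {t : ℝ} (ht : 0 ≤ t)
    (htT : 2 < t * ‖T‖) {F : E → E} {p : E}
    (hF : (fun z => F z - p - (1 - t • T) (z - p)) =O[𝓝 p] fun z => ‖z - p‖ ^ 2) :
    ∃ ε > 0, ∀ δ > 0, ∃ z₀, dist z₀ p < δ ∧ ∃ n : ℕ, ε ≤ dist (F^[n] z₀) p := by
  refine SOMI.exists_iterate_dist_ge (fun x y => ?_) ?_ hF
  · simp [inner_sub_left, inner_sub_right, real_inner_smul_left, real_inner_smul_right,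
      hT.inner_left_eq_inner_right]
  · rw [IsPositive.norm_one_sub_smul hT ht htT.le]
    linarith

theorem IsPositive.dense_exists_iterate_dist_ge {T : E →L[ℝ] E} (hT : T.IsPositive) {t a : ℝ}
    (ht : 0 < t) (hta : 2 ≤ t * a) (haT : a < ‖T‖) (ha : a ∉ spectrum ℝ T) {F : E → E} {p : E}
    (hF : HasStrictFDerivAt F (1 - t • T) p) :
    ∃ ε > 0, Dense {z₀ | ∃ n : ℕ, ε ≤ dist (F^[n] z₀) p} := by
  have ha0 : 0 < a := by by_contra h; nlinarith
  rw [spectrum.notMem_iff] at ha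
  obtain ⟨c, hc, hcx⟩ := exists_norm_le_of_isUnit ha
  -- At `a = 2 / t` the factor `t a - 1` would be exactly one. Moving to `b > a` makes `g > 1`,
  -- while `b < a + c` keeps `T - b` bounded below.
  obtain ⟨b, hab, hb⟩ := exists_between (lt_min (show a < a + c by linarith) haT)
  rw [lt_min_iff] at hb
  set S : E →L[ℝ] E := T - b • 1 with hS
  have hSx : ∀ x, S x = T x - b • x := fun x => by simp [hS]
  have hSsymm : ∀ x y, ⟪S x, y⟫ = ⟪x, S y⟫ := fun x y => by
    rw [hSx, hSx, inner_sub_left, inner_sub_right, real_inner_smul_left, real_inner_smul_right,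
      hT.inner_left_eq_inner_right]
  have hSnorm : ∀ x, (a + c - b) * ‖x‖ ≤ ‖S x‖ := fun x => by
    have h1 := hcx x
    have h2 : (algebraMap ℝ (E →L[ℝ] E) a - T) x = (a - b) • x - S x := by
      simp [hSx, Algebra.algebraMap_eq_smul_one, sub_smul]
    rw [h2] at h1
    have h3 := norm_sub_le ((a - b) • x) (S x)
    rw [norm_smul, Real.norm_eq_abs, abs_of_neg (by linarith)] at h3
    linarith
  set g := t * b - 1 with hg
  have hg1 : 1 < g := by
    have : t * a < t * b := by gcongr
    linarith
  have hd : 0 < a + c - b := by linarith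
  obtain ⟨x₀, hx₀⟩ := IsPositive.exists_lt_inner hT (ha0.trans hab).le hb.2
  refine SOMI.dense_exists_iterate_dist_ge (S := S) (g := g ^ 2)
    (c := t * (g - 1) * (a + c - b) ^ 2) hF (mul_pos (mul_pos ht (by linarith)) (by positivity))
    (by nlinarith) (fun x => ?_) (x₀ := x₀) ?_
  · set s := S x with hs
    -- With `T = S + b`, the coefficient of `‖s‖ ^ 2` in the form at the image becomes `2 g t - t ^
    -- 2 b = t (g - 1) > 0`, apart from the nonnegative term `t ^ 2 ⟪T s, s⟫`.
    have hD : (1 - t • T) x = -(g • x) - t • s := by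
      rw [hs, hSx, hg]
      simp only [sub_apply, one_apply_eq_self, smul_apply]
      module
    have h1 : ⟪S s, x⟫ = ‖s‖ ^ 2 := by
      rw [hSsymm, ← hs, real_inner_self_eq_norm_sq]
    have h2 : ⟪S s, s⟫ = ⟪T s, s⟫ - b * ‖s‖ ^ 2 := by
      rw [hSx s, inner_sub_left, real_inner_smul_left, real_inner_self_eq_norm_sq]
    have h3 : ⟪S ((1 - t • T) x), (1 - t • T) x⟫ =
        g ^ 2 * ⟪s, x⟫ + t * (g - 1) * ‖s‖ ^ 2 + t ^ 2 * ⟪T s, s⟫ := by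
      rw [hD]
      simp only [map_sub, map_neg, map_smul, ← hs, inner_sub_left, inner_sub_right, inner_neg_left,
        inner_neg_right, real_inner_smul_left, real_inner_smul_right, h1, h2,
        real_inner_self_eq_norm_sq]
      rw [hg]
      ring
    rw [h3]
    have h4 : ((a + c - b) * ‖x‖) ^ 2 ≤ ‖s‖ ^ 2 := by gcongr; exact hSnorm x
    have h5 := mul_le_mul_of_nonneg_left h4 (mul_pos ht (show 0 < g - 1 by linarith)).le
    have h6 := mul_nonneg (sq_nonneg t) (IsPositive.inner_nonneg hT s)
    nlinarith
  · rw [hSx, inner_sub_left, real_inner_smul_left, real_inner_self_eq_norm_sq]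
    linarith

end LinearizedIteration

/-! ### Turning a coercive form into a Hilbert space structure -/

section Renorming

universe u

/-- A copy of `X`, to be given another norm. -/
def Renormed (X : Type*) : Type _ := X

instance (X : Type*) [AddCommGroup X] : AddCommGroup (Renormed X) := inferInstanceAs (AddCommGroup X)

instance (X : Type*) [AddCommGroup X] [Module ℝ X] : Module ℝ (Renormed X) :=
  inferInstanceAs (Module ℝ X)

/-- The identity map from `X` to its copy. -/
def toRenormed (X : Type*) [AddCommGroup X] [Module ℝ X] : X ≃ₗ[ℝ] Renormed X :=
  LinearEquiv.refl ℝ X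

/-- A coercive bounded symmetric bilinear form on a Banach space is the inner product of an
isomorphic Hilbert space. -/
theorem exists_hilbert_renorming {X : Type u} [NormedAddCommGroup X] [NormedSpace ℝ X]
    [CompleteSpace X] (B : X →L[ℝ] X →L[ℝ] ℝ) (hB : ∀ x y, B x y = B y x) {c : ℝ} (hc : 0 < c)
    (hBc : ∀ x, c * ‖x‖ ^ 2 ≤ B x x) :
    ∃ (Y : Type u) (_ : NormedAddCommGroup Y) (_ : InnerProductSpace ℝ Y) (_ : CompleteSpace Y)
      (e : X ≃L[ℝ] Y), ∀ x y, ⟪e x, e y⟫ = B x y := by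
  set f := (toRenormed X).symm with hf
  let core : InnerProductSpace.Core ℝ (Renormed X) :=
    { inner := fun x y => B (f x) (f y)
      conj_inner_symm := fun x y => hB _ _
      re_inner_nonneg := fun x => by
        have := hBc (f x)
        exact le_trans (by positivity) this
      add_left := fun x y z => by simp
      smul_left := fun x y r => by simp
      definite := fun x hx => by
        have h1 := hBc (f x)
        change B (f x) (f x) = 0 at hx
        rw [hx] at h1
        have h2 : ‖f x‖ ^ 2 ≤ 0 := by
          by_contra! h
          nlinarith
        have h3 : ‖f x‖ = 0 := by nlinarith [norm_nonneg (f x)]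
        simpa using h3 }
  let i1 : NormedAddCommGroup (Renormed X) := core.toNormedAddCommGroup
  let i2 : InnerProductSpace ℝ (Renormed X) := InnerProductSpace.ofCore core.toCore
  have hinner : ∀ x y : X, ⟪toRenormed X x, toRenormed X y⟫ = B x y := fun x y => rfl
  have hnorm : ∀ x : X, ‖toRenormed X x‖ ^ 2 = B x x := fun x => by
    rw [← real_inner_self_eq_norm_sq, hinner]
  have hup : ∀ x : X, ‖toRenormed X x‖ ≤ √‖B‖ * ‖x‖ := fun x => by
    refine le_of_sq_le_sq ?_ (by positivity)
    rw [hnorm, mul_pow, Real.sq_sqrt (norm_nonneg B), sq, ← mul_assoc]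
    exact (le_abs_self _).trans (B.le_opNorm₂ x x)
  have hlow : ∀ y : Renormed X, ‖(toRenormed X).symm y‖ ≤ √c⁻¹ * ‖y‖ := fun y => by
    obtain ⟨x, rfl⟩ := (toRenormed X).surjective y
    rw [LinearEquiv.symm_apply_apply]
    refine le_of_sq_le_sq ?_ (by positivity)
    rw [mul_pow, Real.sq_sqrt (by positivity), hnorm, ← div_eq_inv_mul, le_div_iff₀ hc, mul_comm]
    exact hBc x
  let e : X ≃L[ℝ] Renormed X :=
    { toLinearEquiv := toRenormed X
      continuous_toFun := AddMonoidHomClass.continuous_of_bound (toRenormed X) _ hup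
      continuous_invFun := AddMonoidHomClass.continuous_of_bound (toRenormed X).symm _ hlow }
  refine ⟨Renormed X, i1, i2, ?_, e, hinner⟩
  exact (completeSpace_congr (e := e.toEquiv) e.isUniformEmbedding).1 inferInstance

end Renorming

/-! ### Quadratic remainders -/

section SecondOrder

variable {X W : Type*} [NormedAddCommGroup X] [NormedSpace ℝ X] [NormedAddCommGroup W]
  [NormedSpace ℝ W]

/-- The derivative is Lipschitz near `p`, so on the ball of radius `dist z p` it varies by a
multiple of that radius; the mean value inequality does the rest. -/
theorem ContDiffAt.isBigO_sub_fderiv {f : X → W} {p : X} (hf : ContDiffAt ℝ 2 f p) :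
    (fun z => f z - f p - fderiv ℝ f p (z - p)) =O[𝓝 p] fun z => ‖z - p‖ ^ 2 := by
  have h1 : ContDiffAt ℝ 1 (fderiv ℝ f) p := hf.fderiv_right (by norm_num)
  obtain ⟨L, s, hs, hL⟩ := h1.exists_lipschitzOnWith
  have h2 : ∀ᶠ z in 𝓝 p, DifferentiableAt ℝ f z :=
    (hf.eventually (by simp)).mono fun z hz => hz.differentiableAt (by norm_num)
  obtain ⟨ε, hε, hball⟩ := Metric.eventually_nhds_iff.1 (h2.and (eventually_mem_set.2 hs))
  refine Asymptotics.IsBigO.of_bound L ?_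
  filter_upwards [Metric.ball_mem_nhds p hε] with z hz
  rw [Metric.mem_ball] at hz
  have hsub : ∀ x ∈ Metric.closedBall p (dist z p), dist x p < ε := fun x hx =>
    (Metric.mem_closedBall.1 hx).trans_lt hz
  have := (convex_closedBall p (dist z p)).norm_image_sub_le_of_norm_hasFDerivWithin_le'
    (f := f) (f' := fderiv ℝ f) (φ := fderiv ℝ f p) (C := L * dist z p) (x := p) (y := z)
    (fun x hx => (hball (hsub x hx)).1.hasFDerivAt.hasFDerivWithinAt)
    (fun x hx => by
      rw [← dist_eq_norm]
      refine (hL.dist_le_mul x (hball (hsub x hx)).2 p (hball (by simpa using hε)).2).trans ?_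
      gcongr
      exact hx)
    (by simp) (by simp)
  rw [Real.norm_of_nonneg (by positivity)]
  refine this.trans_eq ?_
  rw [dist_eq_norm]
  ring

theorem hasStrictFDerivAt_clm_apply_of_eq_zero {Z : Type*} [NormedAddCommGroup Z] [NormedSpace ℝ Z]
    {G : X → W →L[ℝ] Z} {r : X → W} {p : X} (hG : ContDiffAt ℝ 1 G p) (hr : ContDiffAt ℝ 2 r p)
    (hrp : r p = 0) :
    HasStrictFDerivAt (fun z => G z (r z)) (G p ∘L fderiv ℝ r p) p := by
  have h1 := (hG.hasStrictFDerivAt one_ne_zero).clm_apply (hr.hasStrictFDerivAt two_ne_zero)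
  refine h1.congr_fderiv ?_
  simp [hrp]

/-- A SOMI step contains `L₁†`, hence is only `C¹` when `L₀₀` is `C²`, and Taylor's theorem gives no
quadratic remainder. It holds nevertheless, because `L₁†` acts on a residual vanishing at `p`, so
`(G z - G p) (r z)` is a product of two first-order terms. -/
theorem isBigO_clm_apply_of_eq_zero {Z : Type*} [NormedAddCommGroup Z] [NormedSpace ℝ Z]
    {G : X → W →L[ℝ] Z} {r : X → W} {p : X} (hG : ContDiffAt ℝ 1 G p) (hr : ContDiffAt ℝ 2 r p)
    (hrp : r p = 0) :
    (fun z => G z (r z) - (G p ∘L fderiv ℝ r p) (z - p)) =O[𝓝 p] fun z => ‖z - p‖ ^ 2 := by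
  have h1 : (fun z => G z - G p) =O[𝓝 p] fun z => z - p :=
    (hG.differentiableAt one_ne_zero).isBigO_sub
  have h2 : r =O[𝓝 p] fun z => z - p := by
    simpa [hrp] using (hr.differentiableAt two_ne_zero).isBigO_sub
  have h3 : (fun z => (G z - G p) (r z)) =O[𝓝 p] fun z => ‖z - p‖ ^ 2 := by
    have h4 : (fun z => ‖G z - G p‖ * ‖r z‖) =O[𝓝 p] fun z => ‖z - p‖ * ‖z - p‖ :=
      h1.norm_norm.mul h2.norm_norm
    refine (Asymptotics.IsBigO.of_bound 1 (Eventually.of_forall fun z => ?_)).trans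
      (h4.congr_right fun z => (sq _).symm)
    rw [one_mul, Real.norm_of_nonneg (by positivity)]
    exact ContinuousLinearMap.le_opNorm _ _
  have h5 : (fun z => G p (r z - r p - fderiv ℝ r p (z - p))) =O[𝓝 p] fun z => ‖z - p‖ ^ 2 :=
    ((G p).isBigO_comp _ _).trans (ContDiffAt.isBigO_sub_fderiv hr)
  refine (h3.add h5).congr_left fun z => ?_
  simp [hrp]

end SecondOrder

/-! ### The energy inner product -/

section Coercivity

variable {V : Type*} [NormedAddCommGroup V] [InnerProductSpace ℝ V]

/-- A positive-definite symmetric isomorphism onto the dual is coercive. -/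
theorem exists_coercive (M : V ≃L[ℝ] StrongDual ℝ V) (hMsymm : ∀ v w, M v w = M w v)
    (hMpos : ∀ v, v ≠ 0 → 0 < M v v) : ∃ c > 0, ∀ v, c * ‖v‖ ^ 2 ≤ M v v := by
  set M' : V →L[ℝ] StrongDual ℝ V := M.toContinuousLinearMap with hM'
  have hnonneg : ∀ v, 0 ≤ M v v := fun v => by
    rcases eq_or_ne v 0 with rfl | hv
    · simp
    · exact (hMpos v hv).le
  have hCS : ∀ v w, (M v w) ^ 2 ≤ M v v * M w w := by
    intro v w
    have h : ∀ s : ℝ, 0 ≤ M w w * (s * s) + 2 * M v w * s + M v v := fun s => by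
      have h1 := hnonneg (v + s • w)
      simp only [map_add, map_smul, add_apply, smul_apply, smul_eq_mul, hMsymm w v] at h1
      linarith
    have h2 := discrim_le_zero h
    rw [discrim] at h2
    linarith
  -- Cauchy–Schwarz for the form `M` controls the dual norm of `M v` by the energy; boundedness of
  -- `M⁻¹` then controls `‖v‖`.
  have hup : ∀ v, ‖M v‖ ^ 2 ≤ ‖M'‖ * M v v := fun v => by
    have h1 : ‖M v‖ ≤ √(‖M'‖ * M v v) := by
      refine ContinuousLinearMap.opNorm_le_bound _ (Real.sqrt_nonneg _) fun w => ?_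
      refine le_of_sq_le_sq ?_ (by positivity)
      rw [mul_pow, Real.sq_sqrt (mul_nonneg (norm_nonneg M') (hnonneg v)), Real.norm_eq_abs, sq_abs]
      have h2 : M w w ≤ ‖M'‖ * ‖w‖ * ‖w‖ := (le_abs_self _).trans (M'.le_opNorm₂ w w)
      calc _ ≤ M v v * M w w := hCS v w
        _ ≤ M v v * (‖M'‖ * ‖w‖ * ‖w‖) := mul_le_mul_of_nonneg_left h2 (hnonneg v)
        _ = _ := by ring
    calc ‖M v‖ ^ 2 ≤ √(‖M'‖ * M v v) ^ 2 := by gcongr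
      _ = _ := Real.sq_sqrt (mul_nonneg (norm_nonneg M') (hnonneg v))
  set N : StrongDual ℝ V →L[ℝ] V := M.symm.toContinuousLinearMap with hN
  refine ⟨((‖N‖ ^ 2 + 1) * (‖M'‖ + 1))⁻¹, by positivity, fun v => ?_⟩
  rw [inv_mul_le_iff₀ (by positivity)]
  have h1 : ‖v‖ ≤ ‖N‖ * ‖M v‖ := by
    have := N.le_opNorm (M v)
    rwa [show N (M v) = v from M.symm_apply_apply v] at this
  calc ‖v‖ ^ 2 ≤ (‖N‖ * ‖M v‖) ^ 2 := by gcongr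
    _ = ‖N‖ ^ 2 * ‖M v‖ ^ 2 := mul_pow _ _ _
    _ ≤ ‖N‖ ^ 2 * (‖M'‖ * M v v) := by gcongr; exact hup v
    _ ≤ (‖N‖ ^ 2 + 1) * ((‖M'‖ + 1) * M v v) := by
        have := hnonneg v
        gcongr <;> linarith
    _ = _ := by ring

/-- The inner product `⟨M v, v'⟩ + ν ν'` on `V × ℝ`. -/
noncomputable def energyForm (M : V ≃L[ℝ] StrongDual ℝ V) : (V × ℝ) →L[ℝ] (V × ℝ) →L[ℝ] ℝ :=
  (M : V →L[ℝ] StrongDual ℝ V).bilinearComp (ContinuousLinearMap.fst ℝ V ℝ)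
      (ContinuousLinearMap.fst ℝ V ℝ) +
    (ContinuousLinearMap.mul ℝ ℝ).bilinearComp (ContinuousLinearMap.snd ℝ V ℝ)
      (ContinuousLinearMap.snd ℝ V ℝ)

@[simp]
theorem energyForm_apply (M : V ≃L[ℝ] StrongDual ℝ V) (z z' : V × ℝ) :
    energyForm M z z' = M z.1 z'.1 + z.2 * z'.2 := rfl

theorem energyForm_coercive {M : V ≃L[ℝ] StrongDual ℝ V} {c : ℝ} (hc : 0 < c)
    (hM : ∀ v, c * ‖v‖ ^ 2 ≤ M v v) (z : V × ℝ) : min c 1 * ‖z‖ ^ 2 ≤ energyForm M z z := by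
  have h1 := hM z.1
  have h0 : 0 ≤ c * ‖z.1‖ ^ 2 := by positivity
  have h2 : ‖z.2‖ ^ 2 = z.2 * z.2 := by rw [Real.norm_eq_abs, sq_abs, sq]
  have h3 : 0 ≤ z.2 * z.2 := mul_self_nonneg _
  rw [energyForm_apply, Prod.norm_def]
  rcases max_cases ‖z.1‖ ‖z.2‖ with ⟨h, -⟩ | ⟨h, -⟩ <;> rw [h]
  · have : min c 1 * ‖z.1‖ ^ 2 ≤ c * ‖z.1‖ ^ 2 := by gcongr; exact min_le_left _ _
    linarith
  · have : min c 1 * ‖z.2‖ ^ 2 ≤ 1 * ‖z.2‖ ^ 2 := by gcongr; exact min_le_right _ _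
    linarith

end Coercivity

/-! ### The SOMI step and its linearization -/

section Iteration

variable {V : Type*} [NormedAddCommGroup V] [InnerProductSpace ℝ V]
  {H : Type*} [NormedAddCommGroup H] [InnerProductSpace ℝ H]
  {M : V ≃L[ℝ] StrongDual ℝ V} {ι : V →L[ℝ] H} {L00 : V → StrongDual ℝ V} {u : V} {μ : ℝ}

@[simp]
theorem toDual_apply (v w : V) : toDual ι v w = ⟪ι v, ι w⟫ := rfl

@[simp]
theorem L1adj_apply (v w : V) : L1adj ι L00 μ u v w = L1 ι L00 μ u w v := rfl

@[simp]
theorem linResidual_apply (z : V × ℝ) :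
    linResidual ι L00 μ u z = L1 ι L00 μ u z.1 - z.2 • toDual ι u := by
  simp [linResidual]

theorem L1_eq {v : V} (h : DifferentiableAt ℝ L00 v) (ν : ℝ) :
    L1 ι L00 ν v = fderiv ℝ L00 v - ν • toDual ι :=
  (h.hasFDerivAt.sub ((toDual ι).hasFDerivAt.const_smul ν)).fderiv

/-- The operator `w ↦ (-M⁻¹ L₁† w, ⟨u, w⟩)`, adjoint to the linearized residual up to sign. -/
noncomputable def feedback (M : V ≃L[ℝ] StrongDual ℝ V) (ι : V →L[ℝ] H)
    (L00 : V → StrongDual ℝ V) (z : V × ℝ) : V →L[ℝ] V × ℝ :=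
  (-((M.symm : StrongDual ℝ V →L[ℝ] V) ∘L L1adj ι L00 z.2 z.1)).prod (toDual ι z.1)

/-- The preconditioned residual `M⁻¹ L₀ u`. -/
noncomputable def residual (M : V ≃L[ℝ] StrongDual ℝ V) (ι : V →L[ℝ] H)
    (L00 : V → StrongDual ℝ V) (z : V × ℝ) : V :=
  M.symm (L0 ι L00 z.2 z.1)

/-- Isolates the factor `residual`, which vanishes at every solution: solutions are fixed points,
and `feedback` need not be differentiated there. -/
theorem step_eq (Δt : ℝ) (z : V × ℝ) :
    step M ι L00 Δt z = z + Δt • feedback M ι L00 z (residual M ι L00 z) := by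
  ext
  · simp [step, feedback, residual, sub_eq_add_neg]
  · simp [step, feedback, residual]

theorem step_eq_self {Δt : ℝ} {z : V × ℝ} (h : L0 ι L00 z.2 z.1 = 0) :
    step M ι L00 Δt z = z := by
  simp [step_eq, residual, h]

theorem augmented_eq :
    augmented M ι L00 μ u =
      feedback M ι L00 (u, μ) ∘L ((M.symm : StrongDual ℝ V →L[ℝ] V) ∘L linResidual ι L00 μ u) := by
  ext <;> simp [augmented, feedback]

/-- The right side is symmetric and nonpositive on the diagonal, which is the source of all spectral
information on `𝓛_I`. The `μ` update supplies exactly the term `⟨u, ·⟩` needed to complete the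
adjoint. -/
theorem energyForm_augmented (hMsymm : ∀ v w, M v w = M w v) (z z' : V × ℝ) :
    energyForm M (augmented M ι L00 μ u z) z' =
      -M (M.symm (linResidual ι L00 μ u z)) (M.symm (linResidual ι L00 μ u z')) := by
  rw [hMsymm (M.symm (linResidual ι L00 μ u z)), augmented_eq]
  simp only [energyForm_apply, feedback, ContinuousLinearMap.comp_apply,
    ContinuousLinearMap.prod_apply, ContinuousLinearEquiv.apply_symm_apply, neg_apply, map_neg,
    ContinuousLinearEquiv.coe_coe, L1adj_apply, toDual_apply]
  rw [linResidual_apply z']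
  simp only [sub_apply, smul_apply, smul_eq_mul, toDual_apply]
  ring

theorem contDiffAt_residual (hsmooth : ContDiffAt ℝ 2 L00 u) :
    ContDiffAt ℝ 2 (residual M ι L00) (u, μ) := by
  have h1 : ContDiffAt ℝ 2 (fun z : V × ℝ => L00 z.1) (u, μ) :=
    ContDiffAt.comp (u, μ) (g := L00) hsmooth contDiffAt_fst
  have h2 : ContDiffAt ℝ 2 (fun z : V × ℝ => toDual ι z.1) (u, μ) :=
    (toDual ι).contDiff.contDiffAt.comp (u, μ) contDiffAt_fst
  exact (M.symm : StrongDual ℝ V →L[ℝ] V).contDiff.contDiffAt.comp (u, μ)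
    (h1.sub (contDiffAt_snd.smul h2))

theorem contDiffAt_feedback (hsmooth : ContDiffAt ℝ 2 L00 u) :
    ContDiffAt ℝ 1 (feedback M ι L00) (u, μ) := by
  have h1 : ContDiffAt ℝ 1 (fun z : V × ℝ => fderiv ℝ L00 z.1) (u, μ) :=
    ContDiffAt.comp (u, μ) (g := fderiv ℝ L00) (hsmooth.fderiv_right (by norm_num)) contDiffAt_fst
  have h0 : ContDiffAt ℝ 1 ((ContinuousLinearMap.snd ℝ V ℝ).smulRight (toDual ι)) (u, μ) :=
    (ContinuousLinearMap.contDiff _).contDiffAt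
  have h2 : ContDiffAt ℝ 1 (fun z : V × ℝ => fderiv ℝ L00 z.1 - z.2 • toDual ι) (u, μ) :=
    h1.sub h0
  have h3 : ContDiffAt ℝ 1 (fun z : V × ℝ => L1 ι L00 z.2 z.1) (u, μ) := by
    refine h2.congr_of_eventuallyEq ?_
    have hd : ∀ᶠ v in 𝓝 u, DifferentiableAt ℝ L00 v :=
      (hsmooth.eventually (by simp)).mono fun v hv => hv.differentiableAt (by norm_num)
    exact (continuousAt_fst.eventually hd).mono fun z hz => L1_eq hz z.2
  have hflip : IsBoundedLinearMap ℝ fun A : V →L[ℝ] StrongDual ℝ V => A.flip :=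
    { map_add := fun A B => rfl
      map_smul := fun c A => rfl
      bound := ⟨1, one_pos, fun A => by rw [one_mul]; exact A.opNorm_flip.le⟩ }
  have h4 : ContDiffAt ℝ 1 (fun z : V × ℝ => L1adj ι L00 z.2 z.1) (u, μ) :=
    hflip.contDiff.contDiffAt.comp (u, μ) h3
  have h5 : ContDiffAt ℝ 1 (fun z : V × ℝ => toDual ι z.1) (u, μ) :=
    (toDual ι).contDiff.contDiffAt.comp (u, μ) contDiffAt_fst
  have h6 : ContDiffAt ℝ 1
      (fun z : V × ℝ => -((M.symm : StrongDual ℝ V →L[ℝ] V) ∘L L1adj ι L00 z.2 z.1)) (u, μ) :=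
    (contDiffAt_const.clm_comp h4).neg
  -- The pairing is written as a sum of compositions with fixed injections, to which the smoothness
  -- rules for composition apply.
  have h7 : ContDiffAt ℝ 1 (fun z : V × ℝ => ContinuousLinearMap.inl ℝ V ℝ ∘L
      (-((M.symm : StrongDual ℝ V →L[ℝ] V) ∘L L1adj ι L00 z.2 z.1)) +
        ContinuousLinearMap.inr ℝ V ℝ ∘L toDual ι z.1) (u, μ) :=
    (contDiffAt_const.clm_comp h6).add (contDiffAt_const.clm_comp h5)
  refine h7.congr_of_eventuallyEq (Eventually.of_forall fun z => ?_)
  ext v <;> simp [feedback]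

theorem fderiv_residual (hsmooth : ContDiffAt ℝ 2 L00 u) :
    fderiv ℝ (residual M ι L00) (u, μ) =
      (M.symm : StrongDual ℝ V →L[ℝ] V) ∘L linResidual ι L00 μ u := by
  have hd : DifferentiableAt ℝ L00 u := hsmooth.differentiableAt two_ne_zero
  have h1 : HasFDerivAt (fun z : V × ℝ => L00 z.1)
      (fderiv ℝ L00 u ∘L ContinuousLinearMap.fst ℝ V ℝ) (u, μ) :=
    HasFDerivAt.comp (u, μ) (g := L00) hd.hasFDerivAt hasFDerivAt_fst
  have h2 : HasFDerivAt (fun z : V × ℝ => toDual ι z.1)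
      (toDual ι ∘L ContinuousLinearMap.fst ℝ V ℝ) (u, μ) :=
    (toDual ι).hasFDerivAt.comp (u, μ) hasFDerivAt_fst
  have h3 := h1.sub ((hasFDerivAt_snd (p := (u, μ))).smul h2)
  have h4 := (M.symm : StrongDual ℝ V →L[ℝ] V).hasFDerivAt.comp (u, μ) h3
  refine HasFDerivAt.fderiv (h4.congr_fderiv ?_)
  congr 1
  ext z <;> simp [linResidual, L1_eq hd]

theorem hasStrictFDerivAt_step (hsmooth : ContDiffAt ℝ 2 L00 u) (hsol : L0 ι L00 μ u = 0)
    (Δt : ℝ) :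
    HasStrictFDerivAt (step M ι L00 Δt) (1 + Δt • augmented M ι L00 μ u) (u, μ) := by
  have h := hasStrictFDerivAt_clm_apply_of_eq_zero (contDiffAt_feedback (M := M) (ι := ι) (μ := μ)
    hsmooth) (contDiffAt_residual (M := M) (ι := ι) (μ := μ) hsmooth) (by simp [residual, hsol])
  rw [fderiv_residual hsmooth, ← augmented_eq] at h
  exact ((hasStrictFDerivAt_id (u, μ)).add (h.const_smul Δt)).congr_of_eventuallyEq
    (Eventually.of_forall fun z => (step_eq Δt z).symm)

theorem isBigO_step (hsmooth : ContDiffAt ℝ 2 L00 u) (hsol : L0 ι L00 μ u = 0) (Δt : ℝ) :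
    (fun z => step M ι L00 Δt z - (u, μ) - (1 + Δt • augmented M ι L00 μ u) (z - (u, μ)))
      =O[𝓝 (u, μ)] fun z => ‖z - (u, μ)‖ ^ 2 := by
  have h := isBigO_clm_apply_of_eq_zero (contDiffAt_feedback (M := M) (ι := ι) (μ := μ)
    hsmooth) (contDiffAt_residual (M := M) (ι := ι) (μ := μ) hsmooth) (by simp [residual, hsol])
  rw [fderiv_residual hsmooth, ← augmented_eq] at h
  refine (h.const_smul_left Δt).congr_left fun z => ?_
  rw [step_eq, add_apply, one_apply_eq_self, smul_apply, Pi.smul_apply, smul_sub]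
  abel

/-- The new range is the old one plus the line spanned by `u`, and a closed subspace plus a
finite-dimensional one is closed. -/
theorem isClosed_range_linResidual (h : IsClosed (Set.range (L1 ι L00 μ u))) :
    IsClosed (Set.range (linResidual ι L00 μ u)) := by
  have h1 : IsClosed (((L1 ι L00 μ u : V →ₗ[ℝ] StrongDual ℝ V).range : Submodule ℝ _) :
      Set (StrongDual ℝ V)) := by
    rwa [LinearMap.coe_range]
  have h2 := Submodule.isClosed_sup_finiteDimensional _ (Submodule.span ℝ {toDual ι u}) h1
  convert h2
  ext f
  simp only [Set.mem_range, SetLike.mem_coe, Submodule.mem_sup, Submodule.mem_span_singleton,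
    LinearMap.mem_range]
  constructor
  · rintro ⟨z, rfl⟩
    exact ⟨_, ⟨z.1, rfl⟩, _, ⟨-z.2, rfl⟩, by simp [sub_eq_add_neg]⟩
  · rintro ⟨_, ⟨v, rfl⟩, _, ⟨ν, rfl⟩, rfl⟩
    exact ⟨(v, -ν), by
      ext w
      rw [linResidual_apply]
      change L1 ι L00 μ u v w - -ν * toDual ι u w = L1 ι L00 μ u v w + ν * toDual ι u w
      ring⟩

end Iteration

/-! ### Transport of the dynamics to an isomorphic space -/

section Conjugation

theorem range_fderiv_eq_span {V : Type*} [NormedAddCommGroup V] [NormedSpace ℝ V] {s : ℕ}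
    (A : EuclideanSpace ℝ (Fin s) →L[ℝ] V) :
    (A : EuclideanSpace ℝ (Fin s) →ₗ[ℝ] V).range =
      Submodule.span ℝ (Set.range fun j : Fin s => A (EuclideanSpace.single j 1)) := by
  rw [LinearMap.range_eq_map, ← (EuclideanSpace.basisFun (Fin s) ℝ).toBasis.span_eq,
    Submodule.map_span, ← Set.range_comp]
  congr 2
  ext j
  simp

variable {X Y : Type*} [NormedAddCommGroup X] [NormedSpace ℝ X] [NormedAddCommGroup Y]
  [NormedSpace ℝ Y]

theorem exists_dist_map_le (A : X →L[ℝ] Y) : ∃ L > 0, ∀ x y, dist (A x) (A y) ≤ L * dist x y := by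
  refine ⟨‖A‖ + 1, by positivity, fun x y => ?_⟩
  rw [dist_eq_norm, dist_eq_norm, ← map_sub]
  exact (A.le_opNorm _).trans (by gcongr; linarith)

/-- The map `F` in the coordinates given by `e`. -/
def conj (e : X ≃L[ℝ] Y) (F : X → X) (y : Y) : Y := e (F (e.symm y))

theorem iterate_conj_apply (e : X ≃L[ℝ] Y) (F : X → X) (n : ℕ) (x : X) :
    (conj e F)^[n] (e x) = e (F^[n] x) := by
  have h : Function.Semiconj e F (conj e F) := fun x => by simp [conj]
  exact (h.iterate_right n x).symm

theorem iterate_conj (e : X ≃L[ℝ] Y) (F : X → X) (n : ℕ) (y : Y) :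
    (conj e F)^[n] y = e (F^[n] (e.symm y)) := by
  rw [← iterate_conj_apply, e.apply_symm_apply]

theorem hasStrictFDerivAt_conj (e : X ≃L[ℝ] Y) {F : X → X} {D : X →L[ℝ] X} {p : X}
    (h : HasStrictFDerivAt F D p) :
    HasStrictFDerivAt (conj e F) ((e : X →L[ℝ] Y) ∘L D ∘L (e.symm : Y →L[ℝ] X)) (e p) := by
  have h' : HasStrictFDerivAt F D (e.symm (e p)) := by rwa [e.symm_apply_apply]
  exact ((e : X →L[ℝ] Y).hasStrictFDerivAt).comp (e p)
    (h'.comp (e p) (e.symm : Y →L[ℝ] X).hasStrictFDerivAt)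

theorem isBigO_conj (e : X ≃L[ℝ] Y) {F : X → X} {D : X →L[ℝ] X} {p : X}
    (h : (fun z => F z - p - D (z - p)) =O[𝓝 p] fun z => ‖z - p‖ ^ 2) :
    (fun y => conj e F y - e p - ((e : X →L[ℝ] Y) ∘L D ∘L (e.symm : Y →L[ℝ] X)) (y - e p))
      =O[𝓝 (e p)] fun y => ‖y - e p‖ ^ 2 := by
  have ht : Tendsto e.symm (𝓝 (e p)) (𝓝 p) := by
    have := e.symm.continuous.tendsto (e p)
    rwa [e.symm_apply_apply] at this
  have h1 := ((e : X →L[ℝ] Y).isBigO_comp _ _).trans (h.comp_tendsto ht)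
  have h2 : (fun y => e.symm y - p) =O[𝓝 (e p)] fun y => y - e p := by
    have := (e.symm : Y →L[ℝ] X).isBigO_comp (fun y => y - e p) (𝓝 (e p))
    refine this.congr_left fun y => by simp
  refine (h1.trans (h2.norm_norm.pow 2)).congr_left fun y => ?_
  simp [conj]

theorem exists_iterate_dist_ge_of_conj (e : X ≃L[ℝ] Y) {F : X → X} {p : X}
    (h : ∃ ε > 0, ∀ δ > 0, ∃ z, dist z (e p) < δ ∧ ∃ n : ℕ, ε ≤ dist ((conj e F)^[n] z) (e p)) :
    ∃ ε > 0, ∀ δ > 0, ∃ z, dist z p < δ ∧ ∃ n : ℕ, ε ≤ dist (F^[n] z) p := by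
  obtain ⟨ε, hε, h⟩ := h
  obtain ⟨L, hL, hLe⟩ := exists_dist_map_le (e : X →L[ℝ] Y)
  obtain ⟨L', hL', hLe'⟩ := exists_dist_map_le (e.symm : Y →L[ℝ] X)
  refine ⟨ε / L, by positivity, fun δ hδ => ?_⟩
  obtain ⟨z, hz, n, hn⟩ := h (δ / L') (by positivity)
  refine ⟨e.symm z, ?_, n, ?_⟩
  · have h1 := hLe' z (e p)
    simp only [ContinuousLinearEquiv.coe_coe, e.symm_apply_apply] at h1
    rw [lt_div_iff₀ hL'] at hz
    linarith
  · rw [iterate_conj] at hn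
    rw [div_le_iff₀ hL, mul_comm]
    exact hn.trans (hLe _ _)

theorem dense_exists_iterate_dist_ge_of_conj (e : X ≃L[ℝ] Y) {F : X → X} {p : X}
    (h : ∃ ε > 0, Dense {z | ∃ n : ℕ, ε ≤ dist ((conj e F)^[n] z) (e p)}) :
    ∃ ε > 0, Dense {z | ∃ n : ℕ, ε ≤ dist (F^[n] z) p} := by
  obtain ⟨ε, hε, h⟩ := h
  obtain ⟨L, hL, hLe⟩ := exists_dist_map_le (e : X →L[ℝ] Y)
  refine ⟨ε / L, by positivity, (h.preimage e.toHomeomorph.isOpenMap).mono ?_⟩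
  rintro z ⟨n, hn⟩
  change ε ≤ dist ((conj e F)^[n] (e z)) (e p) at hn
  rw [iterate_conj_apply] at hn
  refine ⟨n, ?_⟩
  rw [div_le_iff₀ hL, mul_comm]
  exact hn.trans (hLe _ _)

end Conjugation

end SOMI

/-! ### The spectrum of the augmented operator and the two regimes of the time step -/

theorem mainTheorem7
    {V : Type*} [NormedAddCommGroup V] [InnerProductSpace ℝ V] [CompleteSpace V]
    {H : Type*} [NormedAddCommGroup H] [InnerProductSpace ℝ H] [CompleteSpace H]
    -- the dense inclusion of the energy space
    (ι : V →L[ℝ] H) (hι : Function.Injective ι) (hdense : DenseRange ι)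
    -- the Hermitian positive-definite acceleration operator
    (M : V ≃L[ℝ] StrongDual ℝ V) (hMsymm : ∀ v w, M v w = M w v)
    (hMpos : ∀ v, v ≠ 0 → 0 < M v v)
    -- the solitary wave and its propagation constant
    (L00 : V → StrongDual ℝ V) (u : V) (μ : ℝ)
    (hsmooth : ContDiffAt ℝ 2 L00 u) (hsol : SOMI.L0 ι L00 μ u = 0)
    -- the kernel of the linearization consists of invariance modes
    {s : ℕ} (U : EuclideanSpace ℝ (Fin s) → V) (c₀ : EuclideanSpace ℝ (Fin s))
    (hker : SOMI.KernelOnlyInvarianceModes ι L00 μ u U c₀)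
    -- the wave is not orthogonal to the kernel of the adjoint linearization
    (hnonorth : ∃ φ : V, SOMI.L1adj ι L00 μ u φ = 0 ∧ ⟪ι u, ι φ⟫ ≠ 0) :
    (¬ ∃ F : V, SOMI.L1 ι L00 μ u F = SOMI.toDual ι u) ∧
    ∃ Λ : ℝ, IsLeast (spectrum ℝ (SOMI.augmented M ι L00 μ u)) Λ ∧ Λ < 0 ∧
      -- convergence
      (IsClosed (Set.range (SOMI.L1 ι L00 μ u)) →
        ∀ Δt : ℝ, 0 < Δt → Δt < -2 / Λ →
          ∀ ε > 0, ∃ δ > 0, ∀ z₀ : V × ℝ, dist z₀ (u, μ) < δ →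
            ∃ c : EuclideanSpace ℝ (Fin s), dist c c₀ < ε ∧ SOMI.L0 ι L00 μ (U c) = 0 ∧
              Tendsto (fun n : ℕ => (SOMI.step M ι L00 Δt)^[n] z₀) atTop (𝓝 (U c, μ))) ∧
      -- divergence
      (∀ Δt : ℝ, -2 / Λ < Δt →
        (∃ ε > 0, ∀ δ > 0, ∃ z₀ : V × ℝ, dist z₀ (u, μ) < δ ∧
          ∃ n : ℕ, ε ≤ dist ((SOMI.step M ι L00 Δt)^[n] z₀) (u, μ)) ∧
        ((∃ ν : ℝ, Λ < ν ∧ ν ≤ -2 / Δt ∧ ν ∉ spectrum ℝ (SOMI.augmented M ι L00 μ u)) →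
          ∃ ε > 0, Dense {z₀ : V × ℝ |
            ∃ n : ℕ, ε ≤ dist ((SOMI.step M ι L00 Δt)^[n] z₀) (u, μ)})) := by
  have hnoF : ¬ ∃ F : V, SOMI.L1 ι L00 μ u F = SOMI.toDual ι u := by
    rintro ⟨F, hF⟩
    obtain ⟨φ, hφ, hne⟩ := hnonorth
    apply hne
    have h1 : SOMI.L1adj ι L00 μ u φ F = 0 := by rw [hφ]; rfl
    rw [SOMI.L1adj_apply, hF] at h1
    exact h1
  refine ⟨hnoF, ?_⟩
  obtain ⟨c, hc, hMc⟩ := SOMI.exists_coercive M hMsymm hMpos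
  have hBsymm : ∀ z z', SOMI.energyForm M z z' = SOMI.energyForm M z' z := fun z z' => by
    rw [SOMI.energyForm_apply, SOMI.energyForm_apply, hMsymm, mul_comm z.2]
  -- The product norm on `V × ℝ` is a maximum, not a Hilbert norm, so the dynamics moves to the
  -- isomorphic space `Y`.
  obtain ⟨Y, _, _, _, e, he⟩ := SOMI.exists_hilbert_renorming (SOMI.energyForm M) hBsymm
    (lt_min hc one_pos) (SOMI.energyForm_coercive hc hMc)
  set L := SOMI.augmented M ι L00 μ u with hL
  set R := SOMI.linResidual ι L00 μ u with hR
  set T := -e.conjContinuousAlgEquiv L with hT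
  have hTe : ∀ z, T (e z) = -e (L z) := fun z => by simp [hT]
  have hinner : ∀ z z', ⟪T (e z), e z'⟫ = M (M.symm (R z)) (M.symm (R z')) := fun z z' => by
    rw [hTe, inner_neg_left, he, SOMI.energyForm_augmented hMsymm, neg_neg]
  have hTpos : T.IsPositive := by
    refine ⟨fun x y => ?_, fun x => ?_⟩
    · obtain ⟨z, rfl⟩ := e.surjective x
      obtain ⟨z', rfl⟩ := e.surjective y
      change ⟪T (e z), e z'⟫ = ⟪e z, T (e z')⟫
      rw [real_inner_comm, real_inner_comm, hinner, real_inner_comm, hinner, hMsymm]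
    · obtain ⟨z, rfl⟩ := e.surjective x
      change 0 ≤ ⟪T (e z), e z⟫
      rw [hinner]
      exact le_trans (by positivity) (hMc _)
  have hTzero : ∀ z, T (e z) = 0 ↔ R z = 0 := fun z => by
    constructor
    · intro h
      have h1 := hinner z z
      rw [h, inner_zero_left] at h1
      by_contra hne
      exact (hMpos (M.symm (R z)) (by simpa using hne)).ne h1
    · intro h
      rw [hTe, hL, SOMI.augmented_eq]
      simp [← hR, h]
  have hkerR : ∀ z, R z = 0 ↔ SOMI.L1 ι L00 μ u z.1 = 0 ∧ z.2 = 0 := fun z => by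
    rw [hR, SOMI.linResidual_apply]
    constructor
    · intro h
      -- A nonzero `μ̃` would make `μ̃⁻¹ ũ` a solution of `L₁ F = u`.
      have h2 : z.2 = 0 := by
        by_contra hne
        refine hnoF ⟨z.2⁻¹ • z.1, ?_⟩
        rw [map_smul, sub_eq_zero.1 h, smul_smul, inv_mul_cancel₀ hne, one_smul]
      rw [h2, zero_smul, sub_zero] at h
      exact ⟨h, h2⟩
    · rintro ⟨h1, h2⟩
      rw [h1, h2, zero_smul, sub_zero]
  have hT0 : T ≠ 0 := by
    intro h
    have h1 : R (0, 1) = 0 := (hTzero (0, 1)).1 (by rw [h]; rfl)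
    exact one_ne_zero ((hkerR (0, 1)).1 h1).2
  have hTn : 0 < ‖T‖ := norm_pos_iff.2 hT0
  have hspec : ∀ ν, ν ∈ spectrum ℝ L ↔ -ν ∈ spectrum ℝ T := fun ν => by
    rw [hT, ← Set.mem_neg, spectrum.neg_eq, neg_neg, AlgEquiv.spectrum_eq]
  have hderiv : ∀ t : ℝ, (e : (V × ℝ) →L[ℝ] Y) ∘L (1 + t • L) ∘L
      (e.symm : Y →L[ℝ] V × ℝ) = 1 - t • T := fun t => by
    ext y
    simp [hT]
  have hstrict : ∀ t : ℝ, HasStrictFDerivAt (SOMI.conj e (SOMI.step M ι L00 t)) (1 - t • T)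
      (e (u, μ)) := fun t => by
    rw [← hderiv]
    exact SOMI.hasStrictFDerivAt_conj e (SOMI.hasStrictFDerivAt_step hsmooth hsol t)
  refine ⟨-‖T‖, ⟨?_, ?_⟩, by linarith, ?_, ?_⟩
  · rw [hspec, neg_neg]
    exact SOMI.IsPositive.norm_mem_spectrum hTpos hT0
  · intro ν hν
    have h1 := spectrum.norm_le_norm_mul_of_mem ((hspec ν).1 hν)
    have h2 : ‖(1 : Y →L[ℝ] Y)‖ ≤ 1 :=
      ContinuousLinearMap.norm_id_le
    have h3 : ‖T‖ * ‖(1 : Y →L[ℝ] Y)‖ ≤ ‖T‖ * 1 := by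
      gcongr
    have h4 := (le_abs_self (-ν)).trans h1
    linarith
  · intro hclosed t ht htΛ ε hε
    rw [neg_div_neg_eq, lt_div_iff₀ hTn] at htΛ
    set R' : Y →L[ℝ] StrongDual ℝ V :=
      R ∘L (e.symm : Y →L[ℝ] V × ℝ) with hR'
    have hR'e : ∀ z, R' (e z) = R z := fun z => by simp [hR']
    have hkerT : (T : Y →ₗ[ℝ] Y).ker =
        (R' : Y →ₗ[ℝ] StrongDual ℝ V).ker := by
      ext y
      obtain ⟨z, rfl⟩ := e.surjective y
      change T (e z) = 0 ↔ R' (e z) = 0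
      rw [hTzero, hR'e]
    have hrange : IsClosed (Set.range R') := by
      have : Set.range R' = Set.range R := by
        rw [hR']
        exact e.symm.surjective.range_comp R
      rw [this]
      exact SOMI.isClosed_range_linResidual hclosed
    obtain ⟨d, hd, hdR⟩ := SOMI.exists_norm_le_of_isClosed_range R' hrange
    obtain ⟨d', hd', hdM⟩ : ∃ d' > 0, ∀ f, d' * ‖f‖ ≤ ‖M.symm f‖ := by
      obtain ⟨b, hb, hb'⟩ := SOMI.exists_dist_map_le (M : V →L[ℝ] StrongDual ℝ V)
      refine ⟨b⁻¹, by positivity, fun f => ?_⟩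
      rw [inv_mul_le_iff₀ hb]
      simpa using hb' (M.symm f) 0
    -- The constant collects the coercivity of `M` (`c`), the lower bound of `M⁻¹` (`d'`) and that
    -- of the residual off its kernel (`d`).
    have hgap : ∀ x ∈ ((T : Y →ₗ[ℝ] Y).ker)ᗮ,
        (c * (d' * d) ^ 2) * ‖x‖ ^ 2 ≤ ⟪T x, x⟫ := fun x hx => by
      rw [hkerT] at hx
      have h1 := hdR x hx
      obtain ⟨z, rfl⟩ := e.surjective x
      rw [hR'e] at h1
      rw [hinner]
      refine le_trans ?_ (hMc _)
      rw [mul_assoc, ← mul_pow]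
      gcongr
      calc d' * d * ‖e z‖ = d' * (d * ‖e z‖) := mul_assoc _ _ _
        _ ≤ d' * ‖R z‖ := by gcongr
        _ ≤ _ := hdM _
    have hU := hker.smooth.hasStrictFDerivAt one_ne_zero
    have hΦ : HasStrictFDerivAt (fun c => e (U c, μ))
        ((e : (V × ℝ) →L[ℝ] Y) ∘L (fderiv ℝ U c₀).prod 0) c₀ :=
      (e : (V × ℝ) →L[ℝ] Y).hasStrictFDerivAt.comp c₀
        (hU.prodMk (hasStrictFDerivAt_const μ c₀))
    have hK : (((e : (V × ℝ) →L[ℝ] Y) ∘L (fderiv ℝ U c₀).prod 0 :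
        EuclideanSpace ℝ (Fin s) →L[ℝ] Y) :
          EuclideanSpace ℝ (Fin s) →ₗ[ℝ] Y).range =
        (T : Y →ₗ[ℝ] Y).ker := by
      have hL1 : ∀ v, SOMI.L1 ι L00 μ u v = 0 ↔ ∃ a, fderiv ℝ U c₀ a = v := fun v => by
        have h1 := SetLike.ext_iff.1 (hker.kernel.trans
          (SOMI.range_fderiv_eq_span (fderiv ℝ U c₀)).symm) v
        exact h1
      ext y
      obtain ⟨⟨v, ν⟩, rfl⟩ := e.surjective y
      change (∃ a, e (fderiv ℝ U c₀ a, (0 : ℝ)) = e (v, ν)) ↔ T (e (v, ν)) = 0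
      rw [hTzero, hkerR, hL1]
      constructor
      · rintro ⟨a, ha⟩
        have h1 := e.injective ha
        exact ⟨⟨a, congrArg Prod.fst h1⟩, (congrArg Prod.snd h1).symm⟩
      · rintro ⟨⟨a, ha⟩, hν⟩
        exact ⟨a, by rw [ha]; exact congrArg e (Prod.ext rfl hν.symm)⟩
    have hfix : ∀ᶠ c in 𝓝 c₀,
        SOMI.conj e (SOMI.step M ι L00 t) (e (U c, μ)) = e (U c, μ) := by
      filter_upwards [hker.solution] with a ha
      rw [SOMI.conj, e.symm_apply_apply, SOMI.step_eq_self ha]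
    -- Intersecting with the set of `c` for which `U c` is a solution ensures that the limit is
    -- itself a solitary wave.
    have hmain := SOMI.IsPositive.eventually_exists_tendsto_iterate hTpos ht htΛ
      (by positivity) hgap (hstrict t) hΦ (by rw [hker.base]) hfix hK
      (Filter.inter_mem (Metric.ball_mem_nhds c₀ hε) hker.solution)
    have hmain' := (e.continuous.tendsto (u, μ)).eventually hmain
    obtain ⟨δ, hδ, hδz⟩ := Metric.eventually_nhds_iff.1 hmain'
    refine ⟨δ, hδ, fun z hz => ?_⟩
    obtain ⟨a, ⟨ha1, ha2⟩, ha3⟩ := hδz hz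
    refine ⟨a, ha1, ha2, ?_⟩
    have h1 := (e.symm.continuous.tendsto _).comp ha3
    rw [e.symm_apply_apply] at h1
    refine h1.congr fun n => ?_
    simp [SOMI.iterate_conj_apply]
  · intro t htΛ
    rw [neg_div_neg_eq] at htΛ
    have ht : 0 < t := lt_trans (by positivity) htΛ
    rw [div_lt_iff₀ hTn] at htΛ
    constructor
    · refine SOMI.exists_iterate_dist_ge_of_conj e
        (SOMI.IsPositive.exists_iterate_dist_ge hTpos ht.le htΛ ?_)
      rw [← hderiv]
      exact SOMI.isBigO_conj e (SOMI.isBigO_step hsmooth hsol t)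
    · rintro ⟨ν, hν1, hν2, hν3⟩
      rw [le_div_iff₀ ht] at hν2
      exact SOMI.dense_exists_iterate_dist_ge_of_conj e
        (SOMI.IsPositive.dense_exists_iterate_dist_ge hTpos ht (a := -ν) (by linarith)
          (by linarith) (by rwa [← hspec]) (hstrict t))
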